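/- Let $d\ge 1$ and let $\{\varepsilon(\mathbf j):\mathbf j\in\mathbb Z^d\}$ be independent random variables with mean $0$ and variance $1$ such that $\{\varepsilon(\mathbf j)^2\}$ is uniformly integrable. Let $\mu\in\mathbb R$, let $\alpha:\mathbb Z^d\to\mathbb R$ satisfy $\sum_{\mathbf i}\alpha(\mathbf i)^2<\infty$, and let $$Z(\mathbf i)=\mu+\sum_{\mathbf j\in\mathbb Z^d}\alpha(\mathbf i-\mathbf j)\,\varepsilon(\mathbf j),\qquad \mathbf i\in\mathbb Z^d,$$ where the series converges in mean square. Let $R_0\subset(-1/2,1/2]^d$ be open and connected, with $\mathbf 0\in R_0$ and with boundary of Lebesgue measure zero. Let $\lambda_n>0$, $\lambda_n\to\infty$, and $S_n=\sum_{\mathbf i\in \lambda_nR_0\cap\mathbb Z^d}Z(\mathbf i)$. Write $\|\cdot\|$ for the Euclidean norm and $\lfloor\mathbf x\rfloor$ for the componentwise integer part of $\mathbf x$. For $t>0$ put $\gamma(t)=\max\{|\alpha(\lfloor t\mathbf u\rfloor)|:\|\mathbf u\|=1\}$ and $g_t(\mathbf x)=\alpha(\lfloor t\mathbf x\rfloor)/\gamma(t)$.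 Suppose that for some $\beta\in(d/2,d)$ the following two conditions hold. (C.1) $\gamma(t)=t^{-\beta}L(t)$ for all $t>0$, where $L:(0,\infty)\to[0,\infty)$ is bounded on every bounded subinterval of $(0,\infty)$ and $\lim_{t\to\infty}\sup\{L(at)/L(t):a\in[a_0,a_1]\}=1$ for all $0<a_0<a_1<\infty$. (C.2) There is a measurable function $g_\infty:\mathbb R^d\to\mathbb R$ such that $\int_{\|\mathbf x\|\ge\delta}|g_t(\mathbf x)-g_\infty(\mathbf x)|^2\,d\mathbf x\to0$ as $t\to\infty$, for every $\delta>0$. Then the integral $G_\infty(\mathbf x)=\int_{R_0}g_\infty(\mathbf y-\mathbf x)\,d\mathbf y$ converges absolutely for every $\mathbf x\in\mathbb R^d$, $G_\infty\in L^2(\mathbb R^d)$, and, as $n\to\infty$, $$\frac{S_n-ES_n}{[\lambda_n^{3d-2\beta}L(\lambda_n)^2]^{1/2}}\ \longrightarrow\ N\Bigl(0,\int_{\mathbb R^d}G_\infty(\mathbf x)^2\,d\mathbf x\Bigr)\quad\text{in distribution},$$ where $N(0,0)$ denotes the point mass at $0$. -/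

import Mathlib

open MeasureTheory ProbabilityTheory Filter Topology
open scoped Pointwise

noncomputable section

namespace SpatialLinear

/-- The lattice point `i ∈ ℤ^d` regarded as a point of `ℝ^d`. -/
def latticePt {d : ℕ} (i : Fin d → ℤ) : EuclideanSpace ℝ (Fin d) :=
  WithLp.toLp 2 (fun k => (i k : ℝ))

/-- The componentwise integer part of a point of `ℝ^d`. -/
def floorVec {d : ℕ} (x : EuclideanSpace ℝ (Fin d)) : Fin d → ℤ :=
  fun k => ⌊x k⌋

/-- A prototype sampling region: an open connected subset of `(-1/2, 1/2]^d` that contains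
the origin and whose boundary is a Lebesgue null set. -/
structure IsPrototype {d : ℕ} (R₀ : Set (EuclideanSpace ℝ (Fin d))) : Prop where
  isOpen : IsOpen R₀
  isConnected : IsConnected R₀
  subset_cube : ∀ x ∈ R₀, ∀ k, x k ∈ Set.Ioc (-(1 / 2) : ℝ) (1 / 2)
  zero_mem : 0 ∈ R₀
  volume_frontier : volume (frontier R₀) = 0

/-- The data sites in the inflated region `s R₀`, that is, the points of `s R₀ ∩ ℤ^d`. -/
def sites {d : ℕ} (R₀ : Set (EuclideanSpace ℝ (Fin d))) (s : ℝ) : Set (Fin d → ℤ) :=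
  {i | latticePt i ∈ s • R₀}

/-- There are finitely many data sites, so that the sum over them is a genuine finite sum. -/
theorem sites_finite {d : ℕ} {R₀ : Set (EuclideanSpace ℝ (Fin d))} (hR : IsPrototype R₀)
    (s : ℝ) : (sites R₀ s).Finite := by
  refine (Set.finite_Icc (fun _ : Fin d => -⌈|s|⌉) (fun _ => ⌈|s|⌉)).subset ?_
  rintro i ⟨x, hx, hxi⟩
  have key : ∀ k, |(i k : ℝ)| ≤ |s| := by
    intro k
    have h1 : (i k : ℝ) = s * x k := by
      have := congrArg (fun v : EuclideanSpace ℝ (Fin d) => v k) hxi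
      simpa [latticePt] using this.symm
    have h2 := hR.subset_cube x hx k
    have h3 : |x k| ≤ 1 := abs_le.2 ⟨by linarith [h2.1], by linarith [h2.2]⟩
    rw [h1, abs_mul]
    exact mul_le_of_le_one_right (abs_nonneg s) h3
  constructor
  · intro k
    have h1 := (abs_le.1 (key k)).1
    have h2 := Int.le_ceil |s|
    have : ((-⌈|s|⌉ : ℤ) : ℝ) ≤ (i k : ℝ) := by push_cast; linarith
    exact_mod_cast this
  · intro k
    have h1 := (abs_le.1 (key k)).2
    have h2 := Int.le_ceil |s|
    have : (i k : ℝ) ≤ ((⌈|s|⌉ : ℤ) : ℝ) := h1.trans h2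
    exact_mod_cast this

/-- The innovations: independent random variables with mean zero and variance one, whose
squares are uniformly integrable. -/
structure IsInnovation {d : ℕ} {Ω : Type*} [MeasurableSpace Ω] (P : Measure Ω)
    (ε : (Fin d → ℤ) → Ω → ℝ) : Prop where
  measurable : ∀ j, Measurable (ε j)
  indep : iIndepFun ε P
  memLp : ∀ j, MemLp (ε j) 2 P
  mean : ∀ j, ∫ ω, ε j ω ∂P = 0
  variance : ∀ j, variance (ε j) P = 1
  uniformIntegrable : UniformIntegrable (fun j ω => ε j ω ^ 2) 1 P

/-- `Z(i) = m + ∑_{j ∈ ℤ^d} α(i - j) ε(j)`. The coefficients are only square summable, so the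
series is the unconditional limit of its finite partial sums in mean square, and each `Z(i)` is
determined up to a null event. -/
structure IsLinearProcess {d : ℕ} {Ω : Type*} [MeasurableSpace Ω] (P : Measure Ω)
    (m : ℝ) (α : (Fin d → ℤ) → ℝ) (ε Z : (Fin d → ℤ) → Ω → ℝ) : Prop where
  aemeasurable : ∀ i, AEMeasurable (Z i) P
  tendsto : ∀ i, Tendsto
    (fun F : Finset (Fin d → ℤ) =>
      eLpNorm (fun ω => Z i ω - (m + ∑ j ∈ F, α (i - j) * ε j ω)) 2 P) atTop (𝓝 0)

/-- The sum `∑_{i ∈ s R₀ ∩ ℤ^d} Z(i)` of the observations. -/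
def siteSum {d : ℕ} {Ω : Type*} (R₀ : Set (EuclideanSpace ℝ (Fin d))) (s : ℝ)
    (Z : (Fin d → ℤ) → Ω → ℝ) (ω : Ω) : ℝ :=
  ∑ᶠ i ∈ sites R₀ s, Z i ω

/-- `γ(t) = max {|α(⌊t u⌋)| : ‖u‖ = 1}`. For each `t` only finitely many lattice points
`⌊t u⌋` occur, so the supremum is a maximum. -/
def radialMax {d : ℕ} (α : (Fin d → ℤ) → ℝ) (t : ℝ) : ℝ :=
  ⨆ u : Metric.sphere (0 : EuclideanSpace ℝ (Fin d)) 1,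
    |α (floorVec (t • (u : EuclideanSpace ℝ (Fin d))))|

/-- `L : (0, ∞) → [0, ∞)` is slowly varying at infinity: it is bounded on bounded subintervals
of `(0, ∞)`, and `sup {L(a t) / L(t) : a ∈ [a₀, a₁]} → 1` as `t → ∞` whenever `0 < a₀ < a₁`.
The values of `L` outside `(0, ∞)` play no role; the limit forces `L(t) > 0` for large `t`. -/
structure SlowlyVarying (L : ℝ → ℝ) : Prop where
  nonneg : ∀ t, 0 < t → 0 ≤ L t
  bdd : ∀ b, BddAbove (L '' Set.Ioc 0 b)
  tendsto : ∀ a₀ a₁ : ℝ, 0 < a₀ → a₀ < a₁ →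
    Tendsto (fun t => ⨆ a : Set.Icc a₀ a₁, L ((a : ℝ) * t) / L t) atTop (𝓝 1)

/-- The radial maximum of the coefficients is regularly varying: `γ(t) = t ^ (-β) L(t)` for all
`t > 0`, with `β > d/2` and `L` slowly varying. -/
structure CondC1 {d : ℕ} (α : (Fin d → ℤ) → ℝ) (β : ℝ) (L : ℝ → ℝ) : Prop where
  exponent : (d : ℝ) / 2 < β
  slowlyVarying : SlowlyVarying L
  radialMax_eq : ∀ t, 0 < t → radialMax α t = t ^ (-β) * L t

/-- `g_t(x) = α(⌊t x⌋) / γ(t)`. -/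
def rescaled {d : ℕ} (α : (Fin d → ℤ) → ℝ) (t : ℝ) (x : EuclideanSpace ℝ (Fin d)) : ℝ :=
  α (floorVec (t • x)) / radialMax α t

/-- The rescaled coefficients `g_t` converge to `g` away from the origin: for every `δ > 0`, the integral of `|g_t - g| ^ b`
over `{‖x‖ ≥ δ}` tends to zero, where `b = 2` if `β ≤ d` and `b = 1` otherwise. -/
structure CondC2 {d : ℕ} (α : (Fin d → ℤ) → ℝ) (β : ℝ)
    (g : EuclideanSpace ℝ (Fin d) → ℝ) : Prop where
  aemeasurable : AEMeasurable g volume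
  tendsto : ∀ δ : ℝ, 0 < δ → Tendsto
    (fun t : ℝ => ∫⁻ x in {x : EuclideanSpace ℝ (Fin d) | δ ≤ ‖x‖},
      ‖rescaled α t x - g x‖ₑ ^ (if β ≤ (d : ℝ) then 2 else 1 : ℕ)) atTop (𝓝 0)

/-- `G(x) = ∫_{R₀} g(y - x) dy`. -/
def limitG {d : ℕ} (R₀ : Set (EuclideanSpace ℝ (Fin d)))
    (g : EuclideanSpace ℝ (Fin d) → ℝ) (x : EuclideanSpace ℝ (Fin d)) : ℝ :=
  ∫ y in R₀, g (y - x)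

end SpatialLinear

end

/-! Interchanging the sums turns `S_n - E S_n` into a series `∑ b_n(j) ε(j)` with `b_n(j) = ∑ α(i -
j)`, `i` running over the sites. After normalization, a Lindeberg-type theorem
(`tendstoInDistribution_weighted_series`) requires only that the squared weights sum to a convergent
quantity and that the weights tend to zero uniformly in `j`.

With `t = λ_n`, the squared normalizer is `t^d (t^d γ(t))²`. Hence the sum of squared weights is
exactly the squared `L²` norm of the step function `x ↦ b_n(⌊t x⌋) / (t^d γ(t))`, and by
`stepWeight_eq_setIntegral` this function is the integral of `g_t(z - x)` over a discretized copy of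
`R₀`. It remains to prove convergence to `G_∞` in `L²` (`CondC2.tendsto_stepWeight`) and a uniform
bound; the bound gives negligibility because each squared weight carries a factor `t^(-d)`.

The difficulty is the singularity at the origin, where (C.2) says nothing. There a Potter bound
gives `|g_t(x)| ≤ C ‖x‖^(-ρ)` with `β < ρ < d`, which is integrable, so `g_t → g_∞` in `L¹` near the
origin and in `L²` away from it. Convolution with the indicator of a set of finite measure sends
both kinds of convergence to `L²` and to `L^∞`. The discretization error is supported near the
boundary of `R₀`, in a layer of vanishing volume. -/

namespace SpatialLinear

/-! ### Central limit theorem for weighted sums, by characteristic functions. -/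

section CentralLimit

-- Valid for every `y`; used where the random variable is large. The cubic bound below serves where
-- it is truncated.
open Complex in
lemma norm_exp_mul_I_sub_taylor_le_sq (y : ℝ) :
    ‖cexp (y * I) - (1 + y * I - (y : ℂ) ^ 2 / 2)‖ ≤ 4 * y ^ 2 := by
  have hn : ‖(y : ℂ) * I‖ = |y| := by simp
  rcases le_or_gt |y| 1 with hy | hy
  · have h := Complex.exp_bound (x := y * I) (by rw [hn]; exact hy) (n := 3) (by norm_num)
    rw [hn] at h
    have e : ∑ k ∈ Finset.range 3, ((y : ℂ) * I) ^ k / (k.factorial : ℂ)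
        = 1 + y * I - (y : ℂ) ^ 2 / 2 := by
      simp [Finset.sum_range_succ, Nat.factorial, mul_pow]; ring
    rw [e] at h
    refine h.trans ?_
    have : |y| ^ 3 ≤ y ^ 2 := by
      rw [← sq_abs y]; exact pow_le_pow_of_le_one (abs_nonneg y) hy (by norm_num)
    norm_num [Nat.factorial]
    nlinarith [sq_nonneg y]
  · calc ‖cexp (y * I) - (1 + y * I - (y : ℂ) ^ 2 / 2)‖
        ≤ ‖cexp (y * I)‖ + (‖(1 : ℂ)‖ + ‖(y : ℂ) * I‖ + ‖(y : ℂ) ^ 2 / 2‖) :=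
          (norm_sub_le _ _).trans (add_le_add_right ((norm_sub_le _ _).trans
            (add_le_add_left (norm_add_le _ _) _)) _)
      _ = 1 + (1 + |y| + y ^ 2 / 2) := by
          rw [Complex.norm_exp_ofReal_mul_I, hn]; simp
      _ ≤ 4 * y ^ 2 := by
          have := sq_abs y
          nlinarith

open Complex in
lemma norm_exp_mul_I_sub_taylor_le_cube {y : ℝ} (hy : |y| ≤ 1) :
    ‖cexp (y * I) - (1 + y * I - (y : ℂ) ^ 2 / 2)‖ ≤ |y| * y ^ 2 := by
  have hn : ‖(y : ℂ) * I‖ = |y| := by simp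
  have h := Complex.exp_bound (x := y * I) (by rw [hn]; exact hy) (n := 3) (by norm_num)
  rw [hn] at h
  have e : ∑ k ∈ Finset.range 3, ((y : ℂ) * I) ^ k / (k.factorial : ℂ)
      = 1 + y * I - (y : ℂ) ^ 2 / 2 := by
    simp [Finset.sum_range_succ, Nat.factorial, mul_pow]; ring
  rw [e] at h
  refine h.trans ?_
  have e3 : |y| * y ^ 2 = |y| ^ 3 := by rw [← sq_abs y]; ring
  rw [e3]
  exact mul_le_of_le_one_right (by positivity) (by norm_num [Nat.factorial])

lemma norm_exp_neg_sub_le {u : ℝ} (hu : |u| ≤ 1) :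
    ‖Complex.exp (-u) - (1 - u)‖ ≤ u ^ 2 := by
  have h := Real.abs_exp_sub_one_sub_id_le (x := -u) (by simpa using hu)
  have e : Complex.exp (-u) - (1 - u) = ((Real.exp (-u) - 1 - (-u) : ℝ) : ℂ) := by
    push_cast; ring
  rw [e, Complex.norm_real, Real.norm_eq_abs]
  simpa using h

variable {Ω ι : Type*} [MeasurableSpace Ω] {P : Measure Ω} [IsProbabilityMeasure P]

/-- Second order expansion of the characteristic function of a standardized random variable,
with an error controlled by the tail of the second moment. -/
lemma norm_charFun_sub_taylor_le {X : Ω → ℝ} (hX : MemLp X 2 P) (h0 : ∫ ω, X ω ∂P = 0)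
    (h1 : ∫ ω, X ω ^ 2 ∂P = 1) {C η s : ℝ} (hC : 0 ≤ C)
    (htail : ∫ ω, {ω | C ^ 2 ≤ X ω ^ 2}.indicator (fun ω => X ω ^ 2) ω ∂P ≤ η)
    (hs : |s| * C ≤ η) (hη : η ≤ 1) :
    ‖charFun (P.map X) s - (1 - (s : ℂ) ^ 2 / 2)‖ ≤ 5 * η * s ^ 2 := by
  have hXm : AEMeasurable X P := hX.1.aemeasurable
  have hX1 : Integrable X P := hX.integrable one_le_two
  have hX2 : Integrable (fun ω => X ω ^ 2) P := hX.integrable_sq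
  have hI : Integrable (fun ω => {ω | C ^ 2 ≤ X ω ^ 2}.indicator (fun ω => X ω ^ 2) ω) P := by
    refine hX2.indicator₀ ?_
    exact nullMeasurableSet_le aemeasurable_const (hXm.pow_const 2)
  have hc : charFun (P.map X) s = ∫ ω, Complex.exp ((s * X ω : ℝ) * Complex.I) ∂P := by
    rw [charFun_apply_real, integral_map hXm (by fun_prop)]
    simp
  have hexp : Integrable (fun ω => Complex.exp ((s * X ω : ℝ) * Complex.I)) P := by
    refine Integrable.of_bound (C := 1) ?_ (ae_of_all _ fun ω => ?_)
    · have : AEMeasurable (fun ω => Complex.exp ((s * X ω : ℝ) * Complex.I)) P := by fun_prop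
      exact this.aestronglyMeasurable
    · rw [Complex.norm_exp_ofReal_mul_I]
  have hX1c : Integrable (fun ω => (((s * X ω : ℝ) : ℂ)) * Complex.I) P :=
    ((hX1.const_mul s).ofReal (𝕜 := ℂ)).mul_const _
  have hX2c : Integrable (fun ω => (((s * X ω : ℝ) : ℂ)) ^ 2 / 2) P := by
    have := ((hX2.const_mul (s ^ 2)).ofReal (𝕜 := ℂ)).div_const 2
    refine this.congr (ae_of_all _ fun ω => ?_)
    simp [mul_pow]
  have hX1' : Integrable (fun ω => 1 + (((s * X ω : ℝ) : ℂ)) * Complex.I) P :=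
    (integrable_const _).add hX1c
  have hX2' : Integrable (fun ω => 1 + (((s * X ω : ℝ) : ℂ)) * Complex.I
      - (((s * X ω : ℝ) : ℂ)) ^ 2 / 2) P := hX1'.sub hX2c
  have ht : (1 - (s : ℂ) ^ 2 / 2) = ∫ ω, (1 + (s * X ω : ℝ) * Complex.I
      - ((s * X ω : ℝ) : ℂ) ^ 2 / 2) ∂P := by
    have e1 : ∫ ω, (((s * X ω : ℝ) : ℂ)) * Complex.I ∂P = 0 := by
      rw [integral_mul_const, integral_complex_ofReal, integral_const_mul, h0]; simp
    have e2 : ∫ ω, (((s * X ω : ℝ) : ℂ)) ^ 2 / 2 ∂P = (s : ℂ) ^ 2 / 2 := by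
      rw [integral_div]
      have : (fun ω => (((s * X ω : ℝ) : ℂ)) ^ 2) = fun ω => ((s ^ 2 * X ω ^ 2 : ℝ) : ℂ) := by
        ext ω; push_cast; ring
      rw [this, integral_complex_ofReal, integral_const_mul, h1]; simp
    rw [integral_sub hX1' hX2c,
      integral_add (integrable_const _) hX1c, e1, e2]
    simp
  rw [hc, ht, ← integral_sub hexp hX2']
  -- Split at `|X| = C`. Below, `|s X| ≤ η` and the cubic bound gives `η s² X²`; above, the
  -- quadratic bound gives `4 s² X²`, charged to the tail. The total is `(1 + 4) η s²`.
  have hb : Integrable (fun ω => η * s ^ 2 * X ω ^ 2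
      + 4 * s ^ 2 * {ω | C ^ 2 ≤ X ω ^ 2}.indicator (fun ω => X ω ^ 2) ω) P :=
    (hX2.const_mul _).add (hI.const_mul _)
  refine (norm_integral_le_of_norm_le hb (ae_of_all _ fun ω => ?_)).trans ?_
  · by_cases hω : ω ∈ {ω | C ^ 2 ≤ X ω ^ 2}
    · rw [Set.indicator_of_mem hω]
      have := norm_exp_mul_I_sub_taylor_le_sq (s * X ω)
      have hη0 : 0 ≤ η := le_trans (by positivity) hs
      have : 0 ≤ η * s ^ 2 * X ω ^ 2 := by positivity
      nlinarith
    · rw [Set.indicator_of_notMem hω]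
      have hXC : |X ω| ≤ C := by
        have := abs_lt_of_sq_lt_sq (not_le.1 fun h => hω h) hC
        exact this.le
      have hsX : |s * X ω| ≤ η := by
        rw [abs_mul]
        exact (mul_le_mul_of_nonneg_left hXC (abs_nonneg s)).trans hs
      have := norm_exp_mul_I_sub_taylor_le_cube (hsX.trans hη)
      have h2 := mul_le_mul_of_nonneg_right hsX (sq_nonneg (s * X ω))
      nlinarith
  · rw [integral_add (hX2.const_mul _) (hI.const_mul _), integral_const_mul, integral_const_mul,
      h1]
    nlinarith [mul_le_mul_of_nonneg_left htail (sq_nonneg s)]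

/-- A family with mean zero, variance one and uniformly integrable squares has characteristic
functions that agree with the Gaussian one to second order at `0`, uniformly in the family. -/
lemma exists_norm_charFun_sub_le {X : ι → Ω → ℝ} (hX : ∀ j, MemLp (X j) 2 P)
    (h0 : ∀ j, ∫ ω, X j ω ∂P = 0) (h1 : ∀ j, ∫ ω, X j ω ^ 2 ∂P = 1)
    (hUI : UniformIntegrable (fun j ω => X j ω ^ 2) 1 P) {η : ℝ} (hη : 0 < η) :
    ∃ δ > 0, ∀ j s, |s| ≤ δ →
      ‖charFun (P.map (X j)) s - Complex.exp (-((s ^ 2 / 2 : ℝ) : ℂ))‖ ≤ η * s ^ 2 := by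
  -- Six shares of `η'`: five from the Taylor expansion, one from the remainder `s⁴ / 4` of the
  -- Gaussian factor.
  obtain ⟨η', hη', h1', h5⟩ : ∃ η' > 0, η' ≤ 1 ∧ 6 * η' ≤ η :=
    ⟨min 1 (η / 6), lt_min one_pos (by positivity), min_le_left _ _, by
      have := min_le_right 1 (η / 6); linarith⟩
  obtain ⟨K, hK⟩ := hUI.spec one_ne_zero ENNReal.one_ne_top hη'
  have htail : ∀ j, ∫ ω, {ω | √(K : ℝ) ^ 2 ≤ X j ω ^ 2}.indicator (fun ω => X j ω ^ 2) ω ∂P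
      ≤ η' := by
    intro j
    have hk := hK j
    rw [eLpNorm_one_eq_lintegral_enorm] at hk
    have hset : {ω | √(K : ℝ) ^ 2 ≤ X j ω ^ 2} = {ω | K ≤ ‖X j ω ^ 2‖₊} := by
      ext ω
      rw [Set.mem_ofPred, Set.mem_ofPred, Real.sq_sqrt K.coe_nonneg, ← NNReal.coe_le_coe,
        coe_nnnorm,
        Real.norm_of_nonneg (sq_nonneg _)]
    rw [hset]
    refine (le_abs_self _).trans ?_
    rw [← Real.norm_eq_abs]
    refine (norm_integral_le_lintegral_norm _).trans ?_
    refine ENNReal.toReal_le_of_le_ofReal hη'.le ?_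
    simpa only [ofReal_norm] using hk
  refine ⟨min 1 (min (η' / (√K + 1)) η'), by positivity, fun j s hs => ?_⟩
  have hs1 : |s| ≤ 1 := hs.trans (min_le_left _ _)
  have hs2 : |s| * √K ≤ η' := by
    have : |s| ≤ η' / (√K + 1) := hs.trans ((min_le_right _ _).trans (min_le_left _ _))
    rw [le_div_iff₀ (by positivity)] at this
    nlinarith [abs_nonneg s]
  have hs3 : |s| ≤ η' := hs.trans ((min_le_right _ _).trans (min_le_right _ _))
  have hA := norm_charFun_sub_taylor_le (hX j) (h0 j) (h1 j) (Real.sqrt_nonneg _) (htail j) hs2 h1'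
  have hs4 : s ^ 2 ≤ |s| := by rw [← sq_abs]; nlinarith [abs_nonneg s]
  have hB := norm_exp_neg_sub_le (u := s ^ 2 / 2) (by
    rw [abs_of_nonneg (by positivity)]; linarith)
  have hC : (s ^ 2 / 2) ^ 2 ≤ η' * s ^ 2 := by nlinarith [sq_nonneg s]
  have e : charFun (P.map (X j)) s - Complex.exp (-((s ^ 2 / 2 : ℝ) : ℂ))
      = (charFun (P.map (X j)) s - (1 - (s : ℂ) ^ 2 / 2))
        - (Complex.exp (-((s ^ 2 / 2 : ℝ) : ℂ)) - (1 - ((s ^ 2 / 2 : ℝ) : ℂ))) := by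
    push_cast; ring
  rw [e]
  refine (norm_sub_le _ _).trans ?_
  nlinarith [sq_nonneg s]

/-- Telescoping: factors are exchanged one at a time, the others having modulus at most one. -/
lemma norm_prod_sub_prod_le_sum {F : Finset ι} {a b : ι → ℂ} (ha : ∀ i ∈ F, ‖a i‖ ≤ 1)
    (hb : ∀ i ∈ F, ‖b i‖ ≤ 1) : ‖∏ i ∈ F, a i - ∏ i ∈ F, b i‖ ≤ ∑ i ∈ F, ‖a i - b i‖ := by
  classical
  induction F using Finset.induction_on with
  | empty => simp
  | insert i F hi ih =>
    rw [Finset.prod_insert hi, Finset.prod_insert hi, Finset.sum_insert hi]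
    have ih' := ih (fun k hk => ha k (Finset.mem_insert_of_mem hk))
      (fun k hk => hb k (Finset.mem_insert_of_mem hk))
    have hbi := hb i (Finset.mem_insert_self i F)
    have hpa : ‖∏ k ∈ F, a k‖ ≤ 1 := by
      rw [norm_prod]
      exact Finset.prod_le_one (fun _ _ => norm_nonneg _)
        (fun k hk => ha k (Finset.mem_insert_of_mem hk))
    have e : a i * ∏ k ∈ F, a k - b i * ∏ k ∈ F, b k
        = (a i - b i) * ∏ k ∈ F, a k + b i * (∏ k ∈ F, a k - ∏ k ∈ F, b k) := by ring
    rw [e]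
    refine (norm_add_le _ _).trans (add_le_add ?_ ?_)
    · rw [norm_mul]; exact mul_le_of_le_one_right (norm_nonneg _) hpa
    · rw [norm_mul]
      exact (mul_le_of_le_one_left (norm_nonneg _) hbi).trans ih'

/-- The central limit theorem for finite weighted sums with negligible weights. -/
theorem tendstoInDistribution_weighted_sum {X : ι → Ω → ℝ} (hXm : ∀ j, Measurable (X j))
    (hind : iIndepFun X P) (hX : ∀ j, MemLp (X j) 2 P)
    (h0 : ∀ j, ∫ ω, X j ω ∂P = 0) (h1 : ∀ j, ∫ ω, X j ω ^ 2 ∂P = 1)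
    (hUI : UniformIntegrable (fun j ω => X j ω ^ 2) 1 P)
    {c : ℕ → ι → ℝ} {F : ℕ → Finset ι} {v : NNReal}
    (hv : Tendsto (fun n => ∑ j ∈ F n, c n j ^ 2) atTop (𝓝 (v : ℝ)))
    (hc : ∀ η > 0, ∀ᶠ n in atTop, ∀ j, |c n j| ≤ η) :
    TendstoInDistribution (fun n ω => ∑ j ∈ F n, c n j * X j ω) atTop (id : ℝ → ℝ)
      (fun _ => P) (gaussianReal 0 v) where
  forall_aemeasurable n :=
    Finset.aemeasurable_fun_sum _ fun j _ => ((hXm j).const_mul _).aemeasurable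
  tendsto := by
    refine ProbabilityMeasure.tendsto_iff_tendsto_charFun.2 fun t => ?_
    have hmul : ∀ n, iIndepFun (fun j ω => c n j * X j ω) P := fun n =>
      hind.comp (fun j x => c n j * x) (fun j => by fun_prop)
    have hcf : ∀ n, charFun (P.map (fun ω => ∑ j ∈ F n, c n j * X j ω)) t
        = ∏ j ∈ F n, charFun (P.map (X j)) (c n j * t) := by
      intro n
      have := ((hmul n).restrict (F n)).charFun_map_fun_finsetSum_eq_prod
        (fun j _ => ((hXm j).const_mul _).aemeasurable)
      rw [this, Finset.prod_apply]
      refine Finset.prod_congr rfl fun j _ => ?_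
      exact charFun_map_mul_comp (hXm j).aemeasurable _ _
    have hgc : ∀ n, ∏ j ∈ F n, Complex.exp (-(((c n j * t) ^ 2 / 2 : ℝ) : ℂ))
        = Complex.exp (-(((∑ j ∈ F n, c n j ^ 2) * t ^ 2 / 2 : ℝ) : ℂ)) := by
      intro n
      rw [← Complex.exp_sum]
      congr 1
      push_cast
      rw [Finset.sum_neg_distrib, Finset.sum_mul, Finset.sum_div]
      simp_rw [mul_pow]
    have hlim : Tendsto (fun n => Complex.exp (-(((∑ j ∈ F n, c n j ^ 2) * t ^ 2 / 2 : ℝ) : ℂ)))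
        atTop (𝓝 (Complex.exp (-(((v : ℝ) * t ^ 2 / 2 : ℝ) : ℂ)))) := by
      have hcont : Continuous fun x : ℝ => Complex.exp (-((x * t ^ 2 / 2 : ℝ) : ℂ)) := by fun_prop
      exact (hcont.tendsto _).comp hv
    have hG : charFun ((gaussianReal 0 v).map id) t
        = Complex.exp (-(((v : ℝ) * t ^ 2 / 2 : ℝ) : ℂ)) := by
      rw [Measure.map_id, charFun_gaussianReal]
      congr 1
      push_cast
      ring
    -- The comparison is with Gaussian factors of the same variances, whose product is explicit;
    -- only then does the total variance pass to the limit.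
    have hdiff : Tendsto (fun n => charFun (P.map (fun ω => ∑ j ∈ F n, c n j * X j ω)) t
        - Complex.exp (-(((∑ j ∈ F n, c n j ^ 2) * t ^ 2 / 2 : ℝ) : ℂ))) atTop (𝓝 0) := by
      rw [Metric.tendsto_atTop']
      intro r hr
      obtain ⟨η, hη, hηr⟩ : ∃ η > 0, η * ((v + 1) * t ^ 2) < r := by
        refine ⟨r / ((v + 1) * t ^ 2 + 1), by positivity, ?_⟩
        rw [div_mul_eq_mul_div, div_lt_iff₀ (by positivity)]
        nlinarith
      obtain ⟨δ, hδ, hbd⟩ := exists_norm_charFun_sub_le hX h0 h1 hUI hη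
      have hev := (hc (δ / (|t| + 1)) (by positivity)).and
        (hv.eventually (gt_mem_nhds (lt_add_one (v : ℝ))))
      obtain ⟨N, hN⟩ := eventually_atTop.1 hev
      refine ⟨N, fun n hn => ?_⟩
      obtain ⟨hcn, hvn⟩ := hN n hn.le
      rw [dist_zero_right, hcf, ← hgc]
      refine lt_of_le_of_lt (norm_prod_sub_prod_le_sum (fun j _ => ?_) (fun j _ => ?_)) ?_
      · have := Measure.isProbabilityMeasure_map (μ := P) (hXm j).aemeasurable
        exact norm_charFun_le_one _
      · rw [Complex.norm_exp]
        simp only [Complex.neg_re, Complex.ofReal_re]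
        exact Real.exp_le_one_iff.2 (neg_nonpos.2 (by positivity))
      · calc _ ≤ ∑ j ∈ F n, η * (c n j * t) ^ 2 := by
              refine Finset.sum_le_sum fun j _ => hbd j _ ?_
              have := hcn j
              rw [le_div_iff₀ (by positivity)] at this
              rw [abs_mul]
              nlinarith [abs_nonneg (c n j)]
          _ = η * ((∑ j ∈ F n, c n j ^ 2) * t ^ 2) := by
              rw [Finset.sum_mul, Finset.mul_sum]; simp_rw [mul_pow]
          _ ≤ η * ((v + 1) * t ^ 2) := by gcongr
          _ < r := hηr
    have := hdiff.add hlim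
    simp only [sub_add_cancel, zero_add] at this
    rw [← hG] at this
    exact this

/-- The central limit theorem for weighted series converging in mean square. -/
theorem tendstoInDistribution_weighted_series {X : ι → Ω → ℝ} (hXm : ∀ j, Measurable (X j))
    (hind : iIndepFun X P) (hX : ∀ j, MemLp (X j) 2 P)
    (h0 : ∀ j, ∫ ω, X j ω ∂P = 0) (h1 : ∀ j, ∫ ω, X j ω ^ 2 ∂P = 1)
    (hUI : UniformIntegrable (fun j ω => X j ω ^ 2) 1 P)
    {c : ℕ → ι → ℝ} {v : NNReal} (hsum : ∀ n, Summable fun j => c n j ^ 2)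
    (hv : Tendsto (fun n => ∑' j, c n j ^ 2) atTop (𝓝 (v : ℝ)))
    (hc : ∀ η > 0, ∀ᶠ n in atTop, ∀ j, |c n j| ≤ η)
    {Y : ℕ → Ω → ℝ} (hY : ∀ n, AEMeasurable (Y n) P)
    (hYX : ∀ n, Tendsto (fun F : Finset ι => eLpNorm (fun ω => Y n ω - ∑ j ∈ F, c n j * X j ω) 2 P)
      atTop (𝓝 0)) :
    TendstoInDistribution Y atTop (id : ℝ → ℝ) (fun _ => P) (gaussianReal 0 v) := by
  -- Truncate each series at a finite set good both in mean square and for the sum of squares;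
  -- Slutsky's lemma then transfers the limit.
  have hex : ∀ n : ℕ, ∃ F : Finset ι,
      eLpNorm (fun ω => Y n ω - ∑ j ∈ F, c n j * X j ω) 2 P ≤ ENNReal.ofReal (1 / (n + 1)) ∧
      |∑ j ∈ F, c n j ^ 2 - ∑' j, c n j ^ 2| ≤ 1 / (n + 1) := by
    intro n
    have hpos : (0 : ℝ) < 1 / (n + 1) := by positivity
    have e1 := (ENNReal.tendsto_nhds_zero.1 (hYX n)) (ENNReal.ofReal (1 / (n + 1)))
      (ENNReal.ofReal_pos.2 hpos)
    have e2 := (hsum n).hasSum.eventually (Metric.closedBall_mem_nhds _ hpos)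
    obtain ⟨F, hF⟩ := (e1.and e2).exists
    exact ⟨F, hF.1, by simpa [Real.dist_eq] using hF.2⟩
  choose F hF1 hF2 using hex
  have hone : Tendsto (fun n : ℕ => 1 / ((n : ℝ) + 1)) atTop (𝓝 0) :=
    tendsto_one_div_add_atTop_nhds_zero_nat
  have hv' : Tendsto (fun n => ∑ j ∈ F n, c n j ^ 2) atTop (𝓝 (v : ℝ)) := by
    have := (squeeze_zero_norm hF2 hone).add hv
    simpa using this
  have hm : ∀ n, AEMeasurable (fun ω => ∑ j ∈ F n, c n j * X j ω) P := fun n =>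
    Finset.aemeasurable_fun_sum _ fun j _ => ((hXm j).const_mul _).aemeasurable
  refine tendstoInDistribution_of_tendstoInMeasure_sub Y _
    (tendstoInDistribution_weighted_sum hXm hind hX h0 h1 hUI hv' hc) ?_ hY
  refine tendstoInMeasure_of_tendsto_eLpNorm (p := 2) two_ne_zero
    (fun n => ((hY n).sub (hm n)).aestronglyMeasurable) aestronglyMeasurable_zero ?_
  have hz : Tendsto (fun n : ℕ => ENNReal.ofReal (1 / ((n : ℝ) + 1))) atTop (𝓝 0) := by
    simpa using ENNReal.tendsto_ofReal hone
  refine tendsto_of_tendsto_of_tendsto_of_le_of_le tendsto_const_nhds hz (fun _ => zero_le) ?_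
  intro n
  simp only [sub_zero]
  exact hF1 n

end CentralLimit

/-! ### Potter bound for the radial maximum. -/

section Potter

variable {d : ℕ} {α : (Fin d → ℤ) → ℝ} {β : ℝ} {L : ℝ → ℝ}

lemma abs_le_sqrt_tsum {ι : Type*} {a : ι → ℝ} (ha : Summable fun i => a i ^ 2) (i : ι) :
    |a i| ≤ √(∑' i, a i ^ 2) :=
  Real.abs_le_sqrt (ha.le_tsum i fun _ _ => sq_nonneg _)

lemma radialMax_nonneg (t : ℝ) : 0 ≤ radialMax α t := Real.iSup_nonneg fun _ => abs_nonneg _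

lemma radialMax_le (hα : Summable fun i => α i ^ 2) (t : ℝ) :
    radialMax α t ≤ √(∑' i, α i ^ 2) :=
  Real.iSup_le (fun _ => abs_le_sqrt_tsum hα _) (Real.sqrt_nonneg _)

/-- `t x` is `t ‖x‖` times a unit vector; square summability bounds the family whose supremum is
taken. -/
lemma abs_le_radialMax (hα : Summable fun i => α i ^ 2) (t : ℝ)
    {x : EuclideanSpace ℝ (Fin d)} (hx : x ≠ 0) :
    |α (floorVec (t • x))| ≤ radialMax α (t * ‖x‖) := by
  have hx' : ‖x‖ ≠ 0 := norm_ne_zero_iff.2 hx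
  have hbdd : BddAbove (Set.range fun u : Metric.sphere (0 : EuclideanSpace ℝ (Fin d)) 1 =>
      |α (floorVec ((t * ‖x‖) • (u : EuclideanSpace ℝ (Fin d))))|) :=
    ⟨_, by rintro _ ⟨u, rfl⟩; exact abs_le_sqrt_tsum hα _⟩
  have := le_ciSup hbdd ⟨‖x‖⁻¹ • x, by simp [norm_smul, hx']⟩
  have e : (t * ‖x‖) • (‖x‖⁻¹ • x) = t • x := by
    rw [smul_smul, mul_assoc, mul_inv_cancel₀ hx', mul_one]
  rw [e] at this
  exact this

lemma SlowlyVarying.exists_forall_le_mul (hL : SlowlyVarying L) {κ : ℝ} (hκ : 1 < κ) :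
    ∃ T > 0, ∀ t ≥ T, 0 < L t ∧ ∀ a ∈ Set.Icc (1 / 2 : ℝ) 1, L (a * t) ≤ κ * L t := by
  have h := hL.tendsto (1 / 2) 1 (by norm_num) (by norm_num)
  have hev := (h.eventually (lt_mem_nhds (show (1 / 2 : ℝ) < 1 by norm_num))).and
    (h.eventually (gt_mem_nhds hκ))
  obtain ⟨T, hT⟩ := eventually_atTop.1 hev
  refine ⟨max T 1, by positivity, fun t ht => ?_⟩
  have ht0 : 0 < t := lt_of_lt_of_le one_pos ((le_max_right _ _).trans ht)
  obtain ⟨h1, h2⟩ := hT t ((le_max_left _ _).trans ht)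
  -- If `L t = 0`, every quotient is `0` by convention, and so is their supremum, which contradicts
  -- the lower bound `1/2`.
  have hpos : 0 < L t := by
    refine lt_of_le_of_ne (hL.nonneg t ht0) fun h0 => ?_
    rw [← h0] at h1
    simp at h1
    norm_num at h1
  refine ⟨hpos, fun a ha => ?_⟩
  obtain ⟨B, hB⟩ := hL.bdd t
  have hbdd : BddAbove (Set.range fun a : Set.Icc (1 / 2 : ℝ) 1 => L ((a : ℝ) * t) / L t) := by
    refine ⟨B / L t, ?_⟩
    rintro _ ⟨b, rfl⟩
    have hb0 : (0 : ℝ) < b := lt_of_lt_of_le (by norm_num) b.2.1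
    have : L ((b : ℝ) * t) ≤ B :=
      hB ⟨(b : ℝ) * t, ⟨by positivity, mul_le_of_le_one_left ht0.le b.2.2⟩, rfl⟩
    exact div_le_div_of_nonneg_right this hpos.le
  have := (le_ciSup hbdd ⟨a, ha⟩).trans h2.le
  rwa [div_le_iff₀ hpos] at this

/-- A Potter type bound, valid down to the origin since the coefficients are bounded. -/
lemma CondC1.exists_radialMax_le (hα : Summable fun i => α i ^ 2) (h : CondC1 α β L)
    (hβ : 0 < β) {ρ : ℝ} (hρ : β < ρ) :
    ∃ T > 0, ∃ C > 0, ∀ t ≥ T, 0 < radialMax α t ∧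
      ∀ s, 0 < s → s ≤ t → radialMax α s ≤ C * (t / s) ^ ρ * radialMax α t := by
  have hρ0 : 0 < ρ := hβ.trans hρ
  -- With `κ = 2^(ρ - β)`, halving the argument costs at most `2^β · 2^(ρ - β) = 2^ρ`.
  obtain ⟨T, hT0, hT⟩ := h.slowlyVarying.exists_forall_le_mul
    (Real.one_lt_rpow (by norm_num : (1 : ℝ) < 2) (sub_pos.2 hρ))
  have hpos : ∀ t ≥ T, 0 < radialMax α t := by
    intro t ht
    have ht0 : 0 < t := hT0.trans_le ht
    rw [h.radialMax_eq t ht0]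
    exact mul_pos (Real.rpow_pos_of_pos ht0 _) (hT t ht).1
  have hstep : ∀ t ≥ T, ∀ s, t / 2 ≤ s → s ≤ t → radialMax α s ≤ 2 ^ ρ * radialMax α t := by
    intro t ht s hs1 hs2
    have ht0 : 0 < t := hT0.trans_le ht
    have hs0 : 0 < s := by linarith
    have hL := (hT t ht).2 (s / t) ⟨by rw [le_div_iff₀ ht0]; linarith, by
      rw [div_le_iff₀ ht0]; linarith⟩
    rw [div_mul_cancel₀ _ ht0.ne'] at hL
    rw [h.radialMax_eq s hs0, h.radialMax_eq t ht0]
    have hsb : s ^ (-β) ≤ 2 ^ β * t ^ (-β) := by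
      have : s ^ (-β) ≤ (t / 2) ^ (-β) :=
        Real.rpow_le_rpow_of_nonpos (by positivity) hs1 (by linarith)
      refine this.trans (le_of_eq ?_)
      rw [Real.div_rpow ht0.le (by norm_num), Real.rpow_neg (by norm_num : (0 : ℝ) ≤ 2)]
      field_simp
    have e : (2 : ℝ) ^ ρ = 2 ^ β * 2 ^ (ρ - β) := by
      rw [← Real.rpow_add (by norm_num)]; congr 1; ring
    calc s ^ (-β) * L s ≤ (2 ^ β * t ^ (-β)) * (2 ^ (ρ - β) * L t) :=
          mul_le_mul hsb hL (h.slowlyVarying.nonneg s hs0) (by positivity)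
      _ = 2 ^ ρ * (t ^ (-β) * L t) := by rw [e]; ring
  have hiter : ∀ k : ℕ, ∀ s t, T ≤ s → s ≤ t → t ≤ 2 ^ k * s →
      radialMax α s ≤ (2 ^ ρ) ^ k * radialMax α t := by
    intro k
    induction k with
    | zero =>
      intro s t _ h1 h2
      have : s = t := le_antisymm h1 (by simpa using h2)
      simp [this]
    | succ k ih =>
      intro s t hs h1 h2
      have hs0 : 0 < s := hT0.trans_le hs
      have h3 : (1 : ℝ) ≤ 2 ^ k := one_le_pow₀ (by norm_num)
      -- The maximum halves `t` without descending below `s`.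
      have hm := ih s (max s (t / 2)) hs (le_max_left _ _) (max_le (by nlinarith) (by
        rw [pow_succ] at h2; linarith))
      have hm' := hstep t (hs.trans h1) (max s (t / 2)) (le_max_right _ _)
        (max_le h1 (by linarith))
      refine hm.trans ?_
      rw [pow_succ, mul_assoc]
      gcongr
  have hbig : ∀ s t, T ≤ s → s ≤ t → radialMax α s ≤ 2 ^ ρ * (t / s) ^ ρ * radialMax α t := by
    intro s t hs hst
    have hs0 : 0 < s := hT0.trans_le hs
    obtain ⟨k, hk1, hk2⟩ := exists_nat_pow_near ((one_le_div hs0).2 hst) (one_lt_two (α := ℝ))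
    rw [div_lt_iff₀ hs0] at hk2
    refine (hiter (k + 1) s t hs hst hk2.le).trans ?_
    have : ((2 : ℝ) ^ ρ) ^ (k + 1) ≤ 2 ^ ρ * (t / s) ^ ρ := by
      rw [pow_succ, mul_comm, ← Real.rpow_natCast, ← Real.rpow_mul (by norm_num), mul_comm ρ,
        Real.rpow_mul (by norm_num), Real.rpow_natCast]
      gcongr
    exact mul_le_mul_of_nonneg_right this (radialMax_nonneg t)
  set M := √(∑' i, α i ^ 2)
  have hM : 0 ≤ M := Real.sqrt_nonneg _
  have hγT := hpos T le_rfl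
  -- The summand `M / γ(T)` covers `s ≤ T`, where `γ(s) ≤ M` and the estimate from `T` to `t`
  -- applies.
  refine ⟨T, hT0, 2 ^ ρ * (1 + M / radialMax α T), by positivity, fun t ht => ⟨hpos t ht, ?_⟩⟩
  intro s hs0 hst
  have hγt := hpos t ht
  rcases le_total T s with hs | hs
  · refine (hbig s t hs hst).trans ?_
    have : (2 : ℝ) ^ ρ ≤ 2 ^ ρ * (1 + M / radialMax α T) :=
      le_mul_of_one_le_right (by positivity) (by
        have : 0 ≤ M / radialMax α T := by positivity
        linarith)
    have ht0 : 0 < t := hs0.trans_le hst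
    gcongr
  · have ht0 : 0 < t := hT0.trans_le ht
    have h1 := hbig T t le_rfl ht
    calc radialMax α s ≤ M := radialMax_le hα s
      _ = M / radialMax α T * radialMax α T := by field_simp
      _ ≤ M / radialMax α T * (2 ^ ρ * (t / T) ^ ρ * radialMax α t) := by gcongr
      _ ≤ (1 + M / radialMax α T) * (2 ^ ρ * (t / s) ^ ρ * radialMax α t) := by
          gcongr
          linarith
      _ = 2 ^ ρ * (1 + M / radialMax α T) * (t / s) ^ ρ * radialMax α t := by ring

/-- Potter's bound at `s = t ‖x‖`: the ratio `t / s = ‖x‖⁻¹` no longer involves `t`. -/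
lemma CondC1.exists_abs_rescaled_le (hα : Summable fun i => α i ^ 2) (h : CondC1 α β L)
    (hβ : 0 < β) {ρ : ℝ} (hρ : β < ρ) :
    ∃ T > 0, ∃ C > 0, ∀ t ≥ T, 0 < radialMax α t ∧
      ∀ x : EuclideanSpace ℝ (Fin d), x ≠ 0 → ‖x‖ ≤ 1 → |rescaled α t x| ≤ C * ‖x‖ ^ (-ρ) := by
  obtain ⟨T, hT, C, hC, H⟩ := h.exists_radialMax_le hα hβ hρ
  refine ⟨T, hT, C, hC, fun t ht => ⟨(H t ht).1, fun x hx hx1 => ?_⟩⟩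
  have ht0 : 0 < t := hT.trans_le ht
  have hx0 : 0 < ‖x‖ := norm_pos_iff.2 hx
  have hγ := (H t ht).1
  rw [rescaled, abs_div, abs_of_pos hγ, div_le_iff₀ hγ]
  refine (abs_le_radialMax hα t hx).trans
    (((H t ht).2 (t * ‖x‖) (by positivity) (mul_le_of_le_one_right ht0.le hx1)).trans
      (le_of_eq ?_))
  rw [show t / (t * ‖x‖) = ‖x‖⁻¹ by field_simp, Real.inv_rpow hx0.le, Real.rpow_neg hx0.le]

end Potter

/-! ### Convolution with an indicator: mixed `L¹` and `L²` estimates. -/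

section SetConvolution

open scoped ENNReal

lemma ennreal_add_sq_le (a b : ℝ≥0∞) : (a + b) ^ 2 ≤ 4 * (a ^ 2 + b ^ 2) := by
  have h : ∀ a b : ℝ≥0∞, a ≤ b → (a + b) ^ 2 ≤ 4 * (a ^ 2 + b ^ 2) := fun a b hab =>
    calc (a + b) ^ 2 ≤ (b + b) ^ 2 := by gcongr
      _ = 4 * b ^ 2 := by ring
      _ ≤ 4 * (a ^ 2 + b ^ 2) := by gcongr; exact le_add_self
  rcases le_total a b with hab | hab
  · exact h a b hab
  · rw [add_comm a, add_comm (a ^ 2)]; exact h b a hab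

lemma sq_lintegral_le {X : Type*} [MeasurableSpace X] (μ : Measure X) {f : X → ℝ≥0∞}
    (hf : AEMeasurable f μ) : (∫⁻ x, f x ∂μ) ^ 2 ≤ μ Set.univ * ∫⁻ x, f x ^ 2 ∂μ := by
  have h := ENNReal.lintegral_mul_le_Lp_mul_Lq μ Real.HolderConjugate.two_two
    (aemeasurable_const (b := (1 : ℝ≥0∞))) hf
  simp only [Pi.mul_apply, one_mul, ENNReal.one_rpow, lintegral_const] at h
  calc (∫⁻ x, f x ∂μ) ^ 2
      ≤ ((μ Set.univ) ^ (1 / 2 : ℝ) * (∫⁻ x, f x ^ (2 : ℝ) ∂μ) ^ (1 / 2 : ℝ)) ^ 2 := by gcongr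
    _ = μ Set.univ * ∫⁻ x, f x ^ 2 ∂μ := by
        rw [mul_pow, ← ENNReal.rpow_natCast, ← ENNReal.rpow_natCast, ← ENNReal.rpow_mul,
          ← ENNReal.rpow_mul]
        norm_num

variable {E : Type*} [MeasurableSpace E] [AddCommGroup E] {μ : Measure E}

lemma setLIntegral_sub_le [MeasurableAdd E] [μ.IsAddRightInvariant] (h : E → ℝ≥0∞) (A : Set E)
    (x : E) :
    ∫⁻ z in A, h (z - x) ∂μ ≤ ∫⁻ z, h z ∂μ :=
  (setLIntegral_le_lintegral _ _).trans (lintegral_sub_right_eq_self h x).le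

lemma sq_setLIntegral_sub_le_split [MeasurableSub E] {h : E → ℝ≥0∞} (hh : Measurable h)
    (A : Set E) {B : Set E}
    (hB : MeasurableSet B) (x : E) :
    (∫⁻ z in A, h (z - x) ∂μ) ^ 2 ≤ 4 * ((∫⁻ z in A, B.indicator h (z - x) ∂μ) ^ 2
      + (∫⁻ z in A, Bᶜ.indicator h (z - x) ∂μ) ^ 2) := by
  refine le_trans (le_of_eq ?_) (ennreal_add_sq_le _ _)
  have hm : Measurable fun z => B.indicator h (z - x) :=
    (hh.indicator hB).comp (measurable_sub_const x)
  rw [← lintegral_add_left hm]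
  congr 2 with z
  exact (congrFun (Set.indicator_self_add_compl B h) (z - x)).symm

lemma sq_setLIntegral_sub_le_measure_mul [MeasurableSub E] {h : E → ℝ≥0∞}
    (hh : Measurable h) (A : Set E) (x : E) :
    (∫⁻ z in A, h (z - x) ∂μ) ^ 2 ≤ μ A * ∫⁻ z in A, h (z - x) ^ 2 ∂μ := by
  have := sq_lintegral_le (μ.restrict A) (hh.comp (measurable_sub_const x)).aemeasurable
  simpa using this

/-- A pointwise bound for convolution with an indicator, by an `L¹` norm near the origin and an
`L²` norm away from it. -/
lemma sq_setLIntegral_sub_le [MeasurableAdd E] [MeasurableSub E] [μ.IsAddRightInvariant]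
    {h : E → ℝ≥0∞} (hh : Measurable h) (A : Set E) {B : Set E}
    (hB : MeasurableSet B) (x : E) :
    (∫⁻ z in A, h (z - x) ∂μ) ^ 2
      ≤ 4 * ((∫⁻ z in B, h z ∂μ) ^ 2 + μ A * ∫⁻ z in Bᶜ, h z ^ 2 ∂μ) := by
  refine (sq_setLIntegral_sub_le_split hh A hB x).trans ?_
  refine mul_le_mul_right (add_le_add ?_ ?_) 4
  · exact pow_le_pow_left' ((setLIntegral_sub_le _ A x).trans (lintegral_indicator hB _).le) 2
  · refine (sq_setLIntegral_sub_le_measure_mul (hh.indicator hB.compl) A x).trans ?_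
    refine mul_le_mul_right ?_ _
    refine (setLIntegral_sub_le (fun z => Bᶜ.indicator h z ^ 2) A x).trans (le_of_eq ?_)
    rw [← lintegral_indicator hB.compl]
    congr 1 with z
    by_cases hz : z ∈ Bᶜ <;> simp [hz]

lemma lintegral_setLIntegral_sub [MeasurableAdd₂ E] [MeasurableNeg E] [SFinite μ]
    [μ.IsAddLeftInvariant] [μ.IsNegInvariant] {h : E → ℝ≥0∞} (hh : Measurable h) (A : Set E) :
    ∫⁻ x, ∫⁻ z in A, h (z - x) ∂μ ∂μ = μ A * ∫⁻ z, h z ∂μ := by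
  rw [lintegral_lintegral_swap]
  · simp_rw [lintegral_sub_left_eq_self h]
    simp [mul_comm]
  · exact (hh.comp (measurable_snd.sub measurable_fst)).aemeasurable

/-- Young's inequality for convolution with an indicator, in a form mixing `L¹` and `L²`. -/
lemma lintegral_sq_setLIntegral_sub_le [MeasurableAdd₂ E] [MeasurableNeg E] [SFinite μ]
    [μ.IsAddLeftInvariant] [μ.IsAddRightInvariant] [μ.IsNegInvariant] {h : E → ℝ≥0∞}
    (hh : Measurable h) (A : Set E) {B : Set E}
    (hB : MeasurableSet B) :
    ∫⁻ x, (∫⁻ z in A, h (z - x) ∂μ) ^ 2 ∂μ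
      ≤ 4 * (μ A * (∫⁻ z in B, h z ∂μ) ^ 2 + μ A ^ 2 * ∫⁻ z in Bᶜ, h z ^ 2 ∂μ) := by
  have hm : ∀ {f : E → ℝ≥0∞}, Measurable f → Measurable fun x => ∫⁻ z in A, f (z - x) ∂μ := by
    intro f hf
    exact (hf.comp (measurable_snd.sub measurable_fst)).lintegral_prod_right'
      (f := fun p : E × E => f (p.2 - p.1))
  have hh1 := hh.indicator hB
  have hh2 := hh.indicator hB.compl
  refine (lintegral_mono (sq_setLIntegral_sub_le_split hh A hB)).trans ?_
  have hm1 : Measurable fun x => (∫⁻ z in A, B.indicator h (z - x) ∂μ) ^ 2 := (hm hh1).pow_const 2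
  have hm2 : Measurable fun x => (∫⁻ z in A, Bᶜ.indicator h (z - x) ∂μ) ^ 2 :=
    (hm hh2).pow_const 2
  rw [lintegral_const_mul' _ _ (by norm_num), lintegral_add_left hm1]
  refine mul_le_mul_right (add_le_add ?_ ?_) 4
  -- Near part: one factor is bounded by the `L¹` norm, the other is integrated by Tonelli.
  · calc ∫⁻ x, (∫⁻ z in A, B.indicator h (z - x) ∂μ) ^ 2 ∂μ
        ≤ ∫⁻ x, (∫⁻ z in B, h z ∂μ) * ∫⁻ z in A, B.indicator h (z - x) ∂μ ∂μ := by
          refine lintegral_mono fun x => ?_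
          rw [sq]
          exact mul_le_mul_left ((setLIntegral_sub_le _ A x).trans (lintegral_indicator hB _).le) _
      _ = μ A * (∫⁻ z in B, h z ∂μ) ^ 2 := by
          rw [lintegral_const_mul _ (hm hh1), lintegral_setLIntegral_sub hh1,
            lintegral_indicator hB]
          ring
  -- Far part: Cauchy–Schwarz on `A`, then Tonelli for the squared function.
  · calc ∫⁻ x, (∫⁻ z in A, Bᶜ.indicator h (z - x) ∂μ) ^ 2 ∂μ
        ≤ ∫⁻ x, μ A * ∫⁻ z in A, Bᶜ.indicator h (z - x) ^ 2 ∂μ ∂μ :=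
          lintegral_mono fun x => sq_setLIntegral_sub_le_measure_mul hh2 A x
      _ = μ A ^ 2 * ∫⁻ z in Bᶜ, h z ^ 2 ∂μ := by
          rw [lintegral_const_mul _ (hm (hh2.pow_const 2)),
            lintegral_setLIntegral_sub (hh2.pow_const 2), ← mul_assoc, ← sq,
            ← lintegral_indicator hB.compl]
          congr 2 with z
          by_cases hz : z ∈ Bᶜ <;> simp [hz]

end SetConvolution

/-! ### Lattice sums as integrals. -/

section Floor

variable {d : ℕ}

lemma measurable_floorVec : Measurable (floorVec (d := d)) :=
  measurable_pi_iff.2 fun k => Int.measurable_floor.comp (by fun_prop)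

/-- Each fibre of the integer part is a half-open unit cube, of volume one. -/
lemma map_floorVec_volume :
    (volume : Measure (EuclideanSpace ℝ (Fin d))).map floorVec = Measure.count := by
  refine Measure.ext_of_singleton fun j => ?_
  rw [Measure.map_apply measurable_floorVec (measurableSet_singleton j), Measure.count_singleton]
  have e : floorVec ⁻¹' {j} = (WithLp.ofLp : EuclideanSpace ℝ (Fin d) → Fin d → ℝ) ⁻¹'
      (Set.pi Set.univ fun k => Set.Ico (j k : ℝ) (j k + 1)) := by
    ext x
    simp only [Set.mem_preimage, Set.mem_singleton_iff, Set.mem_pi, Set.mem_univ, true_imp_iff,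
      Set.mem_Ico, funext_iff, floorVec, Int.floor_eq_iff]
  rw [e, (PiLp.volume_preserving_ofLp (Fin d)).measure_preimage
    (MeasurableSet.univ_pi fun _ => measurableSet_Ico).nullMeasurableSet, Real.volume_pi_Ico]
  simp

lemma measurable_floorVec_smul (t : ℝ) :
    Measurable fun x : EuclideanSpace ℝ (Fin d) => floorVec (t • x) :=
  measurable_floorVec.comp (measurable_const_smul t)

lemma map_floorVec_smul_volume {t : ℝ} (ht : 0 < t) :
    (volume : Measure (EuclideanSpace ℝ (Fin d))).map (fun x => floorVec (t • x))
      = ENNReal.ofReal ((t ^ d)⁻¹) • Measure.count := by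
  have : (fun x : EuclideanSpace ℝ (Fin d) => floorVec (t • x))
      = floorVec ∘ fun x => t • x := rfl
  rw [this, ← Measure.map_map measurable_floorVec (measurable_const_smul t),
    Measure.map_addHaar_smul _ ht.ne', Measure.map_smul, map_floorVec_volume,
    finrank_euclideanSpace_fin, abs_of_pos (by positivity)]

lemma lintegral_comp_floorVec_smul {t : ℝ} (ht : 0 < t) (f : (Fin d → ℤ) → ENNReal) :
    ∫⁻ x : EuclideanSpace ℝ (Fin d), f (floorVec (t • x))
      = ENNReal.ofReal ((t ^ d)⁻¹) * ∑' i, f i := by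
  rw [← lintegral_map (measurable_of_countable f) (measurable_floorVec_smul t),
    map_floorVec_smul_volume ht, lintegral_smul_measure, lintegral_count, smul_eq_mul]

lemma integral_comp_floorVec_smul {t : ℝ} (ht : 0 < t) {f : (Fin d → ℤ) → ℝ}
    {F : Finset (Fin d → ℤ)} (hf : ∀ i ∉ F, f i = 0) :
    ∫ x : EuclideanSpace ℝ (Fin d), f (floorVec (t • x)) = (t ^ d)⁻¹ * ∑ i ∈ F, f i := by
  rw [← integral_map (measurable_floorVec_smul t).aemeasurable
    (measurable_of_countable f).aestronglyMeasurable,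
    map_floorVec_smul_volume ht, integral_smul_measure, ENNReal.toReal_ofReal (by positivity),
    smul_eq_mul, ← setIntegral_eq_integral_of_forall_compl_eq_zero (s := (F : Set _))
      (by simpa using hf)]
  congr 1
  rw [setIntegral_finset _ (by
    rw [← Set.biUnion_of_singleton (F : Set (Fin d → ℤ))]
    exact integrableOn_finset_iUnion.2 fun i _ => integrableOn_singleton (hx := by simp))]
  simp [Measure.real]

end Floor

/-! ### Convergence of the rescaled coefficients near and away from the origin. -/

section Kernel

open scoped ENNReal

variable {d : ℕ} {α : (Fin d → ℤ) → ℝ} {β : ℝ} {L : ℝ → ℝ} {g : EuclideanSpace ℝ (Fin d) → ℝ}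

lemma measurable_rescaled (t : ℝ) : Measurable (rescaled α t) :=
  ((measurable_of_countable α).comp (measurable_floorVec_smul t)).div_const _

lemma compl_ball_zero {E : Type*} [SeminormedAddCommGroup E] (r : ℝ) :
    (Metric.ball (0 : E) r)ᶜ = {x | r ≤ ‖x‖} := by
  ext x; simp

/-- In polar coordinates the integrand is `y^(d - 1 - ρ)`, with exponent above `-1`. -/
lemma lintegral_norm_rpow_ball_ne_top (hd : 0 < d) {ρ : ℝ} (hρ : ρ < d) :
    ∫⁻ x in Metric.ball (0 : EuclideanSpace ℝ (Fin d)) 1, ENNReal.ofReal (‖x‖ ^ (-ρ)) ≠ ∞ := by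
  have : Nonempty (Fin d) := ⟨⟨0, hd⟩⟩
  have h : IntegrableOn (fun x : EuclideanSpace ℝ (Fin d) => ‖x‖ ^ (-ρ)) (Metric.ball 0 1) := by
    refine (integrableOn_fun_norm_addHaar volume (f := fun y : ℝ => y ^ (-ρ))).2 ?_
    have h1 : IntegrableOn (fun y : ℝ => y ^ ((d : ℝ) - 1 - ρ)) (Set.Ioo 0 1) :=
      (intervalIntegral.integrableOn_Ioo_rpow_iff one_pos).2 (by linarith)
    refine h1.congr_fun (fun y hy => ?_) measurableSet_Ioo
    have hd1 : ((d - 1 : ℕ) : ℝ) = (d : ℝ) - 1 := by rw [Nat.cast_sub hd, Nat.cast_one]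
    simp only [finrank_euclideanSpace_fin, smul_eq_mul]
    rw [← Real.rpow_natCast y, hd1, ← Real.rpow_add hy.1]
    congr 1
  have h2 := h.lintegral_lt_top
  exact h2.ne

/-- The rescaled coefficients are dominated near the origin by an integrable function. -/
lemma CondC1.exists_dominating (hα : Summable fun i => α i ^ 2) (h : CondC1 α β L)
    (hβ : 0 < β) (hβd : β < d) :
    ∃ T > 0, ∃ w : EuclideanSpace ℝ (Fin d) → ℝ≥0∞, Measurable w ∧
      ∫⁻ x in Metric.ball 0 1, w x ≠ ∞ ∧ ∀ t ≥ T, 0 < radialMax α t ∧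
        ∀ x ∈ Metric.ball (0 : EuclideanSpace ℝ (Fin d)) 1, x ≠ 0 → ‖rescaled α t x‖ₑ ≤ w x := by
  -- `ρ > β` absorbs the slowly varying factor; `ρ < d` keeps the bound integrable.
  obtain ⟨ρ, hρ, hρd⟩ := exists_between hβd
  obtain ⟨T, hT, C, hC, H⟩ := h.exists_abs_rescaled_le hα hβ hρ
  have hd : 0 < d := by
    have : (0 : ℝ) < d := hβ.trans hβd
    exact_mod_cast this
  refine ⟨T, hT, fun x => ENNReal.ofReal C * ENNReal.ofReal (‖x‖ ^ (-ρ)), by fun_prop, ?_,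
    fun t ht => ⟨(H t ht).1, fun x hx hx0 => ?_⟩⟩
  · rw [lintegral_const_mul' _ _ ENNReal.ofReal_ne_top]
    exact ENNReal.mul_ne_top ENNReal.ofReal_ne_top (lintegral_norm_rpow_ball_ne_top hd hρd)
  · beta_reduce
    rw [← ENNReal.ofReal_mul hC.le, Real.enorm_eq_ofReal_abs]
    exact ENNReal.ofReal_le_ofReal ((H t ht).2 x hx0 (mem_ball_zero_iff.1 hx).le)

lemma CondC2.tendsto_sq (h : CondC2 α β g) (hβd : β ≤ d) {δ : ℝ} (hδ : 0 < δ) :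
    Tendsto (fun t : ℝ => ∫⁻ x in (Metric.ball (0 : EuclideanSpace ℝ (Fin d)) δ)ᶜ,
      ‖rescaled α t x - g x‖ₑ ^ 2) atTop (𝓝 0) := by
  have := h.tendsto δ hδ
  rw [if_pos hβd] at this
  rwa [compl_ball_zero]

lemma lintegral_sq_rescaled_ne_top (hα : Summable fun i => α i ^ 2) {t : ℝ} (ht : 0 < t) :
    ∫⁻ x, ‖rescaled α t x‖ₑ ^ 2 ≠ ∞ := by
  have e := lintegral_comp_floorVec_smul ht (fun i => ‖α i / radialMax α t‖ₑ ^ 2)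
  change ∫⁻ x, ‖rescaled α t x‖ₑ ^ 2 = _ at e
  rw [e]
  refine ENNReal.mul_ne_top ENNReal.ofReal_ne_top ?_
  have hs : Summable fun i => (α i / radialMax α t) ^ 2 := by
    simp_rw [div_pow]; exact hα.div_const _
  have := hs.tsum_ofReal_ne_top
  convert this using 3 with i
  rw [Real.enorm_eq_ofReal_abs, ← ENNReal.ofReal_pow (abs_nonneg _), sq_abs]

lemma enorm_sq_le_add (a b : ℝ) : ‖a‖ₑ ^ 2 ≤ 4 * (‖a - b‖ₑ ^ 2 + ‖b‖ₑ ^ 2) := by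
  refine le_trans ?_ (ennreal_add_sq_le _ _)
  have := enorm_add_le (a - b) b
  rw [sub_add_cancel] at this
  exact pow_le_pow_left' this 2

/-- Away from the origin `g` lies at finite `L²` distance from a single `g_t`, itself square
integrable because `α` is square summable. -/
lemma CondC2.lintegral_sq_ne_top (hα : Summable fun i => α i ^ 2) (h : CondC2 α β g)
    (hβd : β ≤ d) {δ : ℝ} (hδ : 0 < δ) :
    ∫⁻ x in (Metric.ball 0 δ)ᶜ, ‖g x‖ₑ ^ 2 ≠ ∞ := by
  have hev := ((h.tendsto_sq hβd hδ).eventually (gt_mem_nhds one_pos)).and (eventually_gt_atTop 0)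
  obtain ⟨t, ht1, ht0⟩ := hev.exists
  have hle : ∫⁻ x in (Metric.ball 0 δ)ᶜ, ‖g x‖ₑ ^ 2 ≤ 4 * ((∫⁻ x in (Metric.ball 0 δ)ᶜ,
      ‖rescaled α t x - g x‖ₑ ^ 2) + ∫⁻ x in (Metric.ball 0 δ)ᶜ, ‖rescaled α t x‖ₑ ^ 2) := by
    rw [← lintegral_add_right _ ((measurable_rescaled t).enorm.pow_const 2),
      ← lintegral_const_mul' _ _ (by norm_num)]
    refine lintegral_mono fun x => ?_
    refine (enorm_sq_le_add (g x) (rescaled α t x)).trans (le_of_eq ?_)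
    rw [enorm_sub_rev]
  refine ne_top_of_le_ne_top (ENNReal.mul_ne_top (by norm_num) (ENNReal.add_ne_top.2 ⟨?_, ?_⟩)) hle
  · exact (ht1.trans ENNReal.one_lt_top).ne
  · exact ne_top_of_le_ne_top (lintegral_sq_rescaled_ne_top hα ht0) (setLIntegral_le_lintegral _ _)

lemma CondC2.exists_lintegral_sq_rescaled_le (hα : Summable fun i => α i ^ 2) (h : CondC2 α β g)
    (hg : Measurable g) (hβd : β ≤ d) {δ : ℝ} (hδ : 0 < δ) :
    ∃ W : ℝ≥0∞, W ≠ ∞ ∧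
      ∀ᶠ t in atTop, ∫⁻ x in (Metric.ball 0 δ)ᶜ, ‖rescaled α t x‖ₑ ^ 2 ≤ W := by
  refine ⟨4 * (1 + ∫⁻ x in (Metric.ball 0 δ)ᶜ, ‖g x‖ₑ ^ 2), ENNReal.mul_ne_top (by norm_num)
    (ENNReal.add_ne_top.2 ⟨ENNReal.one_ne_top, h.lintegral_sq_ne_top hα hβd hδ⟩), ?_⟩
  filter_upwards [(h.tendsto_sq hβd hδ).eventually (gt_mem_nhds one_pos)] with t ht
  calc ∫⁻ x in (Metric.ball 0 δ)ᶜ, ‖rescaled α t x‖ₑ ^ 2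
      ≤ ∫⁻ x in (Metric.ball 0 δ)ᶜ, 4 * (‖rescaled α t x - g x‖ₑ ^ 2 + ‖g x‖ₑ ^ 2) :=
        lintegral_mono fun x => enorm_sq_le_add _ _
    _ = 4 * ((∫⁻ x in (Metric.ball 0 δ)ᶜ, ‖rescaled α t x - g x‖ₑ ^ 2)
          + ∫⁻ x in (Metric.ball 0 δ)ᶜ, ‖g x‖ₑ ^ 2) := by
        rw [lintegral_const_mul' _ _ (by norm_num), lintegral_add_right _ (hg.enorm.pow_const 2)]
    _ ≤ _ := by gcongr

/-- An eventual pointwise bound on the rescaled coefficients passes to the limit kernel. -/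
lemma CondC2.ae_enorm_le (h : CondC2 α β g) (hg : Measurable g) (hβd : β ≤ d) {T : ℝ}
    {w : EuclideanSpace ℝ (Fin d) → ℝ≥0∞} (hw : Measurable w)
    (H : ∀ t ≥ T, ∀ x ∈ Metric.ball (0 : EuclideanSpace ℝ (Fin d)) 1, x ≠ 0 →
      ‖rescaled α t x‖ₑ ≤ w x) :
    ∀ᵐ x, x ∈ Metric.ball 0 1 → x ≠ 0 → ‖g x‖ₑ ≤ w x := by
  -- Annuli exhaust the punctured ball. On each, truncated subtraction makes `‖g‖ - w` the excess
  -- over `w`, which is at most `‖g_t - g‖` and hence vanishes almost everywhere.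
  have key : ∀ k : ℕ, ∀ᵐ x, x ∈ Metric.ball (0 : EuclideanSpace ℝ (Fin d)) 1 →
      1 / ((k : ℝ) + 1) ≤ ‖x‖ → ‖g x‖ₑ ≤ w x := by
    intro k
    have hδ : (0 : ℝ) < 1 / ((k : ℝ) + 1) := by positivity
    set S : Set (EuclideanSpace ℝ (Fin d)) :=
      (Metric.ball 0 (1 / ((k : ℝ) + 1)))ᶜ ∩ Metric.ball 0 1 with hS
    have hSm : MeasurableSet S := measurableSet_ball.compl.inter measurableSet_ball
    have hz : ∫⁻ x in S, (‖g x‖ₑ - w x) ^ 2 = 0 := by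
      refine le_antisymm (ge_of_tendsto (h.tendsto_sq hβd hδ) ?_) zero_le
      filter_upwards [eventually_ge_atTop T] with t ht
      calc ∫⁻ x in S, (‖g x‖ₑ - w x) ^ 2 ≤ ∫⁻ x in S, ‖rescaled α t x - g x‖ₑ ^ 2 := by
            refine setLIntegral_mono' hSm fun x hx => ?_
            refine pow_le_pow_left' ?_ 2
            have hx0 : x ≠ 0 := by
              rintro rfl
              exact hx.1 (Metric.mem_ball_self hδ)
            rw [tsub_le_iff_right]
            have h1 := enorm_add_le (g x - rescaled α t x) (rescaled α t x)
            rw [sub_add_cancel, enorm_sub_rev] at h1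
            exact h1.trans (by gcongr; exact H t ht x hx.2 hx0)
        _ ≤ _ := lintegral_mono_set Set.inter_subset_left
    have hm : Measurable fun x => (‖g x‖ₑ - w x) ^ 2 := (hg.enorm.sub hw).pow_const 2
    rw [lintegral_eq_zero_iff hm] at hz
    have hz' := (ae_restrict_iff' hSm).1 hz
    filter_upwards [hz'] with x hx hx1 hxk
    have hxS : x ∈ S := ⟨by rw [compl_ball_zero]; exact hxk, hx1⟩
    have := hx hxS
    simpa [tsub_eq_zero_iff_le] using this
  filter_upwards [ae_all_iff.2 key] with x hx hx1 hx0
  obtain ⟨k, hk⟩ := exists_nat_one_div_lt (norm_pos_iff.2 hx0)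
  exact hx k hx1 hk.le

/-- Convergence in `L¹` near the origin. -/
lemma CondC2.tendsto_lintegral_ball (h : CondC2 α β g) (hg : Measurable g) (hβd : β ≤ d)
    (hd : 0 < d) {T : ℝ} {w : EuclideanSpace ℝ (Fin d) → ℝ≥0∞} (hw : Measurable w)
    (hwi : ∫⁻ x in Metric.ball 0 1, w x ≠ ∞)
    (H : ∀ t ≥ T, ∀ x ∈ Metric.ball (0 : EuclideanSpace ℝ (Fin d)) 1, x ≠ 0 →
      ‖rescaled α t x‖ₑ ≤ w x) :
    Tendsto (fun t : ℝ => ∫⁻ x in Metric.ball (0 : EuclideanSpace ℝ (Fin d)) 1,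
      ‖rescaled α t x - g x‖ₑ) atTop (𝓝 0) := by
  have : Nonempty (Fin d) := ⟨⟨0, hd⟩⟩
  have hgw := h.ae_enorm_le hg hβd hw H
  have hball : Tendsto (fun r : ℝ => (volume.restrict (Metric.ball
      (0 : EuclideanSpace ℝ (Fin d)) 1)) (Metric.ball 0 r)) (𝓝[>] 0) (𝓝 0) := by
    have h1 : Tendsto (fun r : ℝ => volume (Metric.closedBall
        (0 : EuclideanSpace ℝ (Fin d)) r)) (𝓝[>] 0) (𝓝 0) := by
      have := (tendsto_measure_cthickening_of_isCompact (μ := volume)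
        (isCompact_singleton (x := (0 : EuclideanSpace ℝ (Fin d))))).mono_left
          (nhdsWithin_le_nhds (s := Set.Ioi (0 : ℝ)))
      rw [measure_singleton] at this
      refine this.congr' ?_
      filter_upwards [self_mem_nhdsWithin] with r hr
      rw [Metric.cthickening_singleton _ (le_of_lt hr)]
    refine tendsto_of_tendsto_of_tendsto_of_le_of_le tendsto_const_nhds h1 (fun _ => zero_le) ?_
    intro r
    exact (Measure.restrict_apply_le _ _).trans (measure_mono Metric.ball_subset_closedBall)
  have hw2 : ∫⁻ x in Metric.ball (0 : EuclideanSpace ℝ (Fin d)) 1, 2 * w x ≠ ∞ := by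
    rw [lintegral_const_mul _ hw]
    exact ENNReal.mul_ne_top (by norm_num) hwi
  -- Inside a small ball the difference is at most `2 w`, whose integral is small by absolute
  -- continuity; in the rest of the unit ball Cauchy–Schwarz converts `L²` convergence to `L¹`.
  have hsmall := tendsto_setLIntegral_zero hw2 hball
  rw [ENNReal.tendsto_nhds_zero]
  intro ε hε
  have hε2 : 0 < ε / 2 := ENNReal.half_pos hε.ne'
  obtain ⟨r, hr1, hr0⟩ := ((ENNReal.tendsto_nhds_zero.1 hsmall (ε / 2) hε2).and
    self_mem_nhdsWithin).exists
  have hfar : Tendsto (fun t : ℝ => (volume (Metric.ball (0 : EuclideanSpace ℝ (Fin d)) 1) *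
      ∫⁻ x in (Metric.ball (0 : EuclideanSpace ℝ (Fin d)) r)ᶜ, ‖rescaled α t x - g x‖ₑ ^ 2))
      atTop (𝓝 0) := by
    have := ENNReal.Tendsto.const_mul (h.tendsto_sq hβd hr0)
      (Or.inr (measure_ball_lt_top (μ := volume) (x := (0 : EuclideanSpace ℝ (Fin d)))
        (r := 1)).ne)
    simpa using this
  filter_upwards [eventually_ge_atTop T, ENNReal.tendsto_nhds_zero.1 hfar ((ε / 2) ^ 2)
    (by positivity)] with t ht hft
  set μB := volume.restrict (Metric.ball (0 : EuclideanSpace ℝ (Fin d)) 1)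
  have hDm : Measurable fun x => ‖rescaled α t x - g x‖ₑ :=
    ((measurable_rescaled t).sub hg).enorm
  rw [← lintegral_add_compl (μ := μB) _ (measurableSet_ball (x := 0) (ε := r)),
    ← ENNReal.add_halves ε]
  refine add_le_add (le_trans ?_ hr1) ?_
  · refine lintegral_mono_ae (ae_restrict_of_ae ?_)
    refine (ae_restrict_iff' measurableSet_ball).2 ?_
    filter_upwards [hgw, Measure.ae_ne volume 0] with x hx hx0 hxB
    rw [two_mul]
    exact (enorm_sub_le).trans (add_le_add (H t ht x hxB hx0) (hx hxB hx0))
  · have hs := sq_lintegral_le (μB.restrict (Metric.ball 0 r)ᶜ) hDm.aemeasurable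
    have h2 : (∫⁻ x in (Metric.ball 0 r)ᶜ, ‖rescaled α t x - g x‖ₑ ∂μB) ^ 2 ≤ (ε / 2) ^ 2 := by
      refine hs.trans (le_trans ?_ hft)
      refine mul_le_mul' ?_ ?_
      · rw [Measure.restrict_apply_univ]
        exact (measure_mono (Set.subset_univ _)).trans (by simp [μB])
      · exact lintegral_mono' (Measure.restrict_mono le_rfl Measure.restrict_le_self) le_rfl
    exact (ENNReal.pow_right_strictMono two_ne_zero).le_iff_le.1 h2

end Kernel

/-! ### Weights as integrals over a discretized region. -/

section Weights

open scoped ENNReal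

variable {d : ℕ} {α : (Fin d → ℤ) → ℝ} {β : ℝ} {L : ℝ → ℝ} {g : EuclideanSpace ℝ (Fin d) → ℝ}
  {R₀ : Set (EuclideanSpace ℝ (Fin d))}

/-- The coefficient of the innovation at `j` in the sum of the observations over `F`. -/
def weight (α : (Fin d → ℤ) → ℝ) (F : Finset (Fin d → ℤ)) (j : Fin d → ℤ) : ℝ :=
  ∑ i ∈ F, α (i - j)

/-- The normalized weights as a step function on `ℝ^d`. -/
noncomputable def stepWeight (α : (Fin d → ℤ) → ℝ) (F : Finset (Fin d → ℤ)) (t : ℝ)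
    (x : EuclideanSpace ℝ (Fin d)) : ℝ :=
  weight α F (floorVec (t • x)) / (t ^ d * radialMax α t)

/-- The points whose discretization, relative to the cell of `x`, lies in `F`. -/
def cellSet (F : Finset (Fin d → ℤ)) (t : ℝ) (x : EuclideanSpace ℝ (Fin d)) :
    Set (EuclideanSpace ℝ (Fin d)) :=
  {z | floorVec (t • (z - x)) + floorVec (t • x) ∈ F}

lemma measurableSet_cellSet (F : Finset (Fin d → ℤ)) (t : ℝ) (x : EuclideanSpace ℝ (Fin d)) :
    MeasurableSet (cellSet F t x) := by
  have hm : Measurable fun z : EuclideanSpace ℝ (Fin d) =>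
      floorVec (t • (z - x)) + floorVec (t • x) :=
    ((measurable_floorVec_smul t).comp (measurable_sub_const x)).add_const _
  exact hm (F : Set (Fin d → ℤ)).toFinite.measurableSet

lemma measurable_stepWeight (F : Finset (Fin d → ℤ)) (t : ℝ) : Measurable (stepWeight α F t) :=
  ((measurable_of_countable (weight α F)).comp (measurable_floorVec_smul t)).div_const _

/-- An exact identity: with `j = ⌊t x⌋` and `k = ⌊t (z - x)⌋`, membership in the cell set means `k +
j ∈ F`, and each `k` occupies a cell of volume `t^(-d)`; substitute `k = i - j`. -/
lemma stepWeight_eq_setIntegral (F : Finset (Fin d → ℤ)) {t : ℝ} (ht : 0 < t)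
    (x : EuclideanSpace ℝ (Fin d)) :
    stepWeight α F t x = ∫ z in cellSet F t x, rescaled α t (z - x) := by
  classical
  set j := floorVec (t • x) with hj
  set ψ : (Fin d → ℤ) → ℝ := fun k => if k + j ∈ F then α k / radialMax α t else 0
  have h1 : ∫ z in cellSet F t x, rescaled α t (z - x)
      = ∫ z : EuclideanSpace ℝ (Fin d), ψ (floorVec (t • (z - x))) := by
    rw [← integral_indicator (measurableSet_cellSet F t x)]
    congr 1 with z
    by_cases hz : floorVec (t • (z - x)) + j ∈ F
    · rw [Set.indicator_of_mem (show z ∈ cellSet F t x from hz)]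
      simp [ψ, hz, rescaled]
    · rw [Set.indicator_of_notMem (show z ∉ cellSet F t x from hz)]
      simp [ψ, hz]
  rw [h1, integral_sub_right_eq_self (fun z : EuclideanSpace ℝ (Fin d) => ψ (floorVec (t • z))) x,
    integral_comp_floorVec_smul ht (F := F.image fun i => i - j), Finset.sum_image]
  · rw [stepWeight, weight, Finset.mul_sum, Finset.sum_div]
    refine Finset.sum_congr rfl fun i hi => ?_
    simp only [ψ, sub_add_cancel, if_pos hi, hj]
    rw [← div_eq_inv_mul, div_div, mul_comm]
  · intro a _ b _ hab
    simpa using hab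
  · intro k hk
    refine if_neg fun hkF => hk (Finset.mem_image.2 ⟨k + j, hkF, by simp⟩)

/-- A segment with exactly one endpoint in `R` is connected, so it meets the frontier, no farther
from `z` than `p` is. -/
lemma mem_cthickening_frontier {E : Type*} [NormedAddCommGroup E] [NormedSpace ℝ E] {R : Set E}
    (hR : IsOpen R) {z p : E} (h : ¬(z ∈ R ↔ p ∈ R)) {r : ℝ} (hr : dist z p ≤ r) :
    z ∈ Metric.cthickening r (frontier R) := by
  have hne : (segment ℝ z p ∩ frontier R).Nonempty := by
    by_contra hempty
    have hdis : ∀ y ∈ segment ℝ z p, y ∉ frontier R := fun y hy hyf => hempty ⟨y, hy, hyf⟩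
    have hcov : segment ℝ z p ⊆ R ∪ (closure R)ᶜ := by
      intro y hy
      by_cases hyR : y ∈ R
      · exact Or.inl hyR
      · refine Or.inr fun hyc => hdis y hy ?_
        rw [hR.frontier_eq]
        exact ⟨hyc, hyR⟩
    have hz := left_mem_segment ℝ z p
    have hp := right_mem_segment ℝ z p
    have hpre := (convex_segment (𝕜 := ℝ) z p).isPreconnected R (closure R)ᶜ hR
      isClosed_closure.isOpen_compl hcov
    have hcon : ∀ a b, a ∈ segment ℝ z p → b ∈ segment ℝ z p → a ∈ R → b ∉ R → False := by
      intro a b ha hb haR hbR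
      obtain ⟨y, -, hy1, hy2⟩ := hpre ⟨a, ha, haR⟩ ⟨b, hb, (hcov hb).resolve_left hbR⟩
      exact hy2 (subset_closure hy1)
    by_cases hzR : z ∈ R
    · exact hcon z p hz hp hzR fun hpR => h ⟨fun _ => hpR, fun _ => hzR⟩
    · by_cases hpR : p ∈ R
      · exact hcon p z hp hz hpR hzR
      · exact h ⟨fun h => (hzR h).elim, fun h => (hpR h).elim⟩
  obtain ⟨y, hy, hyf⟩ := hne
  refine Metric.mem_cthickening_of_dist_le z y r _ hyf (le_trans ?_ hr)
  have := dist_add_dist_of_mem_segment hy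
  have h2 : 0 ≤ dist y p := dist_nonneg
  linarith

/-- Two integer parts each lose at most one per coordinate, hence `2 / t` per coordinate after
scaling. -/
lemma dist_floorVec_le {t : ℝ} (ht : 0 < t) (x z : EuclideanSpace ℝ (Fin d)) :
    dist z (t⁻¹ • latticePt (floorVec (t • (z - x)) + floorVec (t • x))) ≤ 2 * √d / t := by
  rw [EuclideanSpace.dist_eq]
  have hk : ∀ k, dist (z k) ((t⁻¹ • latticePt (floorVec (t • (z - x)) + floorVec (t • x)) :
      EuclideanSpace ℝ (Fin d)) k) ^ 2 ≤ (2 / t) ^ 2 := by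
    intro k
    refine pow_le_pow_left₀ dist_nonneg ?_ 2
    have e : (t⁻¹ • latticePt (floorVec (t • (z - x)) + floorVec (t • x)) :
        EuclideanSpace ℝ (Fin d)) k = t⁻¹ * ((⌊t * (z k - x k)⌋ : ℝ) + ⌊t * x k⌋) := by
      simp [latticePt, floorVec]
    rw [e, Real.dist_eq]
    have e2 : z k - t⁻¹ * ((⌊t * (z k - x k)⌋ : ℝ) + ⌊t * x k⌋)
        = ((t * (z k - x k) - ⌊t * (z k - x k)⌋) + (t * x k - ⌊t * x k⌋)) / t := by
      field_simp; ring
    rw [e2, abs_div, abs_of_pos ht]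
    refine div_le_div_of_nonneg_right ?_ ht.le
    have a1 := Int.fract_nonneg (t * (z k - x k))
    have a2 := (Int.fract_lt_one (t * (z k - x k))).le
    have a3 := Int.fract_nonneg (t * x k)
    have a4 := (Int.fract_lt_one (t * x k)).le
    simp only [Int.fract] at a1 a2 a3 a4
    rw [abs_le]
    constructor <;> linarith
  calc √(∑ k, _) ≤ √(∑ _k : Fin d, (2 / t) ^ 2) :=
        Real.sqrt_le_sqrt (Finset.sum_le_sum fun k _ => hk k)
    _ = 2 * √d / t := by
      rw [Finset.sum_const, Finset.card_univ, Fintype.card_fin, nsmul_eq_mul,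
        Real.sqrt_mul (Nat.cast_nonneg _), Real.sqrt_sq (by positivity)]
      ring

/-- The finite set of data sites. -/
noncomputable def siteFinset (hR : IsPrototype R₀) (t : ℝ) : Finset (Fin d → ℤ) :=
  (sites_finite hR t).toFinset

lemma mem_siteFinset (hR : IsPrototype R₀) {t : ℝ} (ht : 0 < t) {i : Fin d → ℤ} :
    i ∈ siteFinset hR t ↔ t⁻¹ • latticePt i ∈ R₀ := by
  rw [siteFinset, Set.Finite.mem_toFinset, ← Set.mem_smul_set_iff_inv_smul_mem₀ ht.ne']
  rfl

/-- A shrinking neighbourhood of the boundary, outside of which the discretized region agrees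
with the region itself. -/
def boundaryLayer (R₀ : Set (EuclideanSpace ℝ (Fin d))) (t : ℝ) :
    Set (EuclideanSpace ℝ (Fin d)) :=
  Metric.cthickening (2 * √d / t) (frontier R₀)

lemma mem_boundaryLayer (hR : IsPrototype R₀) {t : ℝ} (ht : 0 < t)
    {x z : EuclideanSpace ℝ (Fin d)} (h : ¬(z ∈ R₀ ↔ z ∈ cellSet (siteFinset hR t) t x)) :
    z ∈ boundaryLayer R₀ t := by
  refine mem_cthickening_frontier hR.isOpen (fun h' => h (h'.trans ?_)) (dist_floorVec_le ht x z)
  exact (mem_siteFinset hR ht).symm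

lemma IsPrototype.isBounded (hR : IsPrototype R₀) : Bornology.IsBounded R₀ := by
  refine (Metric.isBounded_closedBall (x := (0 : EuclideanSpace ℝ (Fin d)))
    (r := √(∑ _k : Fin d, (1 : ℝ)))).subset fun x hx => ?_
  rw [mem_closedBall_zero_iff, EuclideanSpace.norm_eq]
  refine Real.sqrt_le_sqrt (Finset.sum_le_sum fun k _ => ?_)
  have h := hR.subset_cube x hx k
  rw [Real.norm_eq_abs, sq_abs]
  nlinarith [h.1, h.2]

lemma IsPrototype.volume_ne_top (hR : IsPrototype R₀) : volume R₀ ≠ ∞ :=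
  hR.isBounded.measure_lt_top.ne

/-- The frontier is compact, so the volumes of its shrinking thickenings tend to its own volume,
zero. -/
lemma IsPrototype.tendsto_volume_boundaryLayer (hR : IsPrototype R₀) :
    Tendsto (fun t => volume (boundaryLayer R₀ t)) atTop (𝓝 0) := by
  have hc : IsCompact (frontier R₀) := Metric.isCompact_of_isClosed_isBounded isClosed_frontier
    (hR.isBounded.closure.subset frontier_subset_closure)
  have h := tendsto_measure_cthickening_of_isCompact (μ := volume) hc
  rw [hR.volume_frontier] at h
  exact h.comp (tendsto_const_nhds.div_atTop tendsto_id)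

lemma measurableSet_boundaryLayer (t : ℝ) : MeasurableSet (boundaryLayer R₀ t) :=
  Metric.isClosed_cthickening.measurableSet

lemma cellSet_subset (hR : IsPrototype R₀) {t : ℝ} (ht : 0 < t) (x : EuclideanSpace ℝ (Fin d)) :
    cellSet (siteFinset hR t) t x ⊆ R₀ ∪ boundaryLayer R₀ t := by
  intro z hz
  by_cases hzR : z ∈ R₀
  · exact Or.inl hzR
  · exact Or.inr (mem_boundaryLayer hR ht fun h => hzR (h.2 hz))

end Weights

/-! ### The limit function and `L²` convergence to it. -/

section Limit

open scoped ENNReal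

variable {d : ℕ} {α : (Fin d → ℤ) → ℝ} {β : ℝ} {L : ℝ → ℝ} {g : EuclideanSpace ℝ (Fin d) → ℝ}
  {R₀ : Set (EuclideanSpace ℝ (Fin d))}

lemma eLpNorm_two_sq {X : Type*} [MeasurableSpace X] {μ : Measure X} (f : X → ℝ) :
    eLpNorm f 2 μ ^ 2 = ∫⁻ x, ‖f x‖ₑ ^ 2 ∂μ := by
  have := eLpNorm_nnreal_pow_eq_lintegral (f := f) (μ := μ) (p := 2) two_ne_zero
  simpa using this

lemma CondC2.lintegral_ball_ne_top (hα : Summable fun i => α i ^ 2) (hC1 : CondC1 α β L)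
    (h : CondC2 α β g) (hg : Measurable g) (hβ : 0 < β) (hβd : β < d) :
    ∫⁻ x in Metric.ball 0 1, ‖g x‖ₑ ≠ ∞ := by
  have hd : 0 < d := by
    have : (0 : ℝ) < d := hβ.trans hβd
    exact_mod_cast this
  have : Nonempty (Fin d) := ⟨⟨0, hd⟩⟩
  obtain ⟨T, -, w, hw, hwi, H⟩ := hC1.exists_dominating hα hβ hβd
  refine ne_top_of_le_ne_top hwi (lintegral_mono_ae ?_)
  refine (ae_restrict_iff' measurableSet_ball).2 ?_
  filter_upwards [h.ae_enorm_le hg hβd.le hw fun t ht => (H t ht).2, Measure.ae_ne volume 0]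
    with x hx hx0 hxB using hx hxB hx0

/-- The mixed estimate is pointwise, so finiteness holds at every `x`, not just almost everywhere.
-/
lemma CondC2.lintegral_sub_ne_top (hα : Summable fun i => α i ^ 2) (hC1 : CondC1 α β L)
    (h : CondC2 α β g) (hg : Measurable g) (hβ : 0 < β) (hβd : β < d) (hR : IsPrototype R₀)
    (x : EuclideanSpace ℝ (Fin d)) : ∫⁻ z in R₀, ‖g (z - x)‖ₑ ≠ ∞ := by
  have h1 := sq_setLIntegral_sub_le (μ := volume) hg.enorm R₀
    (measurableSet_ball (x := (0 : EuclideanSpace ℝ (Fin d))) (ε := 1)) x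
  have h2 := ne_top_of_le_ne_top (ENNReal.mul_ne_top (by norm_num) (ENNReal.add_ne_top.2
    ⟨ENNReal.pow_ne_top (h.lintegral_ball_ne_top hα hC1 hg hβ hβd),
      ENNReal.mul_ne_top hR.volume_ne_top (h.lintegral_sq_ne_top hα hβd.le one_pos)⟩)) h1
  intro h3
  simp [h3] at h2

lemma CondC2.integrableOn_sub (hα : Summable fun i => α i ^ 2) (hC1 : CondC1 α β L)
    (h : CondC2 α β g) (hg : Measurable g) (hβ : 0 < β) (hβd : β < d) (hR : IsPrototype R₀)
    (x : EuclideanSpace ℝ (Fin d)) : IntegrableOn (fun z => g (z - x)) R₀ :=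
  ⟨(hg.comp (measurable_sub_const x)).aestronglyMeasurable,
    (h.lintegral_sub_ne_top hα hC1 hg hβ hβd hR x).lt_top⟩

lemma measurable_limitG (hg : Measurable g) : Measurable (limitG R₀ g) := by
  have h : StronglyMeasurable fun p : EuclideanSpace ℝ (Fin d) × EuclideanSpace ℝ (Fin d) =>
      g (p.2 - p.1) := (hg.comp (measurable_snd.sub measurable_fst)).stronglyMeasurable
  exact (h.integral_prod_right (ν := volume.restrict R₀)).measurable

lemma CondC2.memLp_limitG (hα : Summable fun i => α i ^ 2) (hC1 : CondC1 α β L)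
    (h : CondC2 α β g) (hg : Measurable g) (hβ : 0 < β) (hβd : β < d) (hR : IsPrototype R₀) :
    MemLp (limitG R₀ g) 2 volume := by
  refine ⟨(measurable_limitG hg).aestronglyMeasurable, ?_⟩
  have h1 := lintegral_sq_setLIntegral_sub_le (μ := volume) hg.enorm R₀
    (measurableSet_ball (x := (0 : EuclideanSpace ℝ (Fin d))) (ε := 1))
  have h2 := ne_top_of_le_ne_top (ENNReal.mul_ne_top (by norm_num) (ENNReal.add_ne_top.2
    ⟨ENNReal.mul_ne_top hR.volume_ne_top
        (ENNReal.pow_ne_top (n := 2) (h.lintegral_ball_ne_top hα hC1 hg hβ hβd)),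
      ENNReal.mul_ne_top (ENNReal.pow_ne_top hR.volume_ne_top)
        (h.lintegral_sq_ne_top hα hβd.le one_pos)⟩)) h1
  have h3 : eLpNorm (limitG R₀ g) 2 volume ^ 2 ≠ ∞ := by
    rw [eLpNorm_two_sq]
    refine ne_top_of_le_ne_top h2 (lintegral_mono fun x => pow_le_pow_left' ?_ 2)
    exact enorm_integral_le_lintegral_enorm _
  refine lt_top_iff_ne_top.2 fun h4 => ?_
  simp [h4] at h3

/-- Uniform control of the rescaled coefficients, in `L¹` near the origin and in `L²` away
from it. -/
lemma CondC2.exists_uniform_bounds (hα : Summable fun i => α i ^ 2) (hC1 : CondC1 α β L)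
    (h : CondC2 α β g) (hg : Measurable g) (hβ : 0 < β) (hβd : β < d) :
    ∃ W₁ W₂ : ℝ≥0∞, W₁ ≠ ∞ ∧ W₂ ≠ ∞ ∧ ∀ᶠ t in atTop,
      ∫⁻ x in Metric.ball 0 1, ‖rescaled α t x‖ₑ ≤ W₁ ∧
      ∫⁻ x in (Metric.ball 0 1)ᶜ, ‖rescaled α t x‖ₑ ^ 2 ≤ W₂ := by
  have hd : 0 < d := by
    have : (0 : ℝ) < d := hβ.trans hβd
    exact_mod_cast this
  have : Nonempty (Fin d) := ⟨⟨0, hd⟩⟩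
  obtain ⟨T, -, w, hw, hwi, H⟩ := hC1.exists_dominating hα hβ hβd
  obtain ⟨W₂, hW₂, hev⟩ := h.exists_lintegral_sq_rescaled_le hα hg hβd.le one_pos
  refine ⟨_, W₂, hwi, hW₂, ?_⟩
  filter_upwards [hev, eventually_ge_atTop T] with t ht htT
  refine ⟨lintegral_mono_ae ?_, ht⟩
  refine (ae_restrict_iff' measurableSet_ball).2 ?_
  filter_upwards [Measure.ae_ne volume 0] with x hx0 hxB using (H t htT).2 x hxB hx0

/-- The integrals representing the normalized weights are eventually uniformly bounded. -/
lemma CondC2.exists_sq_lintegral_cellSet_le (hα : Summable fun i => α i ^ 2) (hC1 : CondC1 α β L)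
    (h : CondC2 α β g) (hg : Measurable g) (hβ : 0 < β) (hβd : β < d) (hR : IsPrototype R₀) :
    ∃ M : ℝ≥0∞, M ≠ ∞ ∧ ∀ᶠ t in atTop, ∀ x,
      (∫⁻ z in cellSet (siteFinset hR t) t x, ‖rescaled α t (z - x)‖ₑ) ^ 2 ≤ M := by
  obtain ⟨W₁, W₂, hW₁, hW₂, hev⟩ := h.exists_uniform_bounds hα hC1 hg hβ hβd
  refine ⟨4 * (W₁ ^ 2 + (volume R₀ + 1) * W₂), ENNReal.mul_ne_top (by norm_num)
    (ENNReal.add_ne_top.2 ⟨ENNReal.pow_ne_top hW₁, ENNReal.mul_ne_top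
      (ENNReal.add_ne_top.2 ⟨hR.volume_ne_top, ENNReal.one_ne_top⟩) hW₂⟩), ?_⟩
  filter_upwards [hev, eventually_gt_atTop 0,
    hR.tendsto_volume_boundaryLayer.eventually (gt_mem_nhds one_pos)] with t ht ht0 hvol x
  refine (sq_setLIntegral_sub_le (μ := volume) (measurable_rescaled t).enorm _
    (measurableSet_ball (x := (0 : EuclideanSpace ℝ (Fin d))) (ε := 1)) x).trans ?_
  gcongr
  · exact ht.1
  · exact (measure_mono (cellSet_subset hR ht0 x)).trans ((measure_union_le _ _).trans
      (by gcongr))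
  · exact ht.2

/-- On `R \ A` one uses `|v| ≤ |u| + |u - v|`, so that only `u` needs control on the exceptional set
`T`. -/
lemma enorm_setIntegral_sub_setIntegral_le {X : Type*} [MeasurableSpace X] {μ : Measure X}
    {A R T : Set X} (hA : MeasurableSet A) (hR : MeasurableSet R) (hT : MeasurableSet T)
    (hART : ∀ z, ¬(z ∈ R ↔ z ∈ A) → z ∈ T) {u v : X → ℝ} (hu : IntegrableOn u A μ)
    (hv : IntegrableOn v R μ) (hum : Measurable u) :
    ‖∫ z in A, u z ∂μ - ∫ z in R, v z ∂μ‖ₑ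
      ≤ ∫⁻ z in T, ‖u z‖ₑ ∂μ + ∫⁻ z in R, ‖u z - v z‖ₑ ∂μ := by
  rw [← integral_indicator hA, ← integral_indicator hR,
    ← integral_sub (hu.integrable_indicator hA) (hv.integrable_indicator hR),
    ← lintegral_indicator hT, ← lintegral_indicator hR,
    ← lintegral_add_left (hum.enorm.indicator hT)]
  refine (enorm_integral_le_lintegral_enorm _).trans (lintegral_mono fun z => ?_)
  by_cases hzA : z ∈ A <;> by_cases hzR : z ∈ R
  · simp [hzA, hzR]
  · have hzT := hART z (by simp [hzA, hzR])
    simp [hzA, hzR, hzT]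
  · have hzT := hART z (by simp [hzA, hzR])
    have := enorm_sub_le (E := ℝ) (a := u z) (b := u z - v z)
    simpa [hzA, hzR, hzT] using this
  · simp [hzA, hzR]

/-- The normalized weights converge in `L²` to the limit function. -/
theorem CondC2.tendsto_stepWeight (hα : Summable fun i => α i ^ 2) (hC1 : CondC1 α β L)
    (h : CondC2 α β g) (hg : Measurable g) (hβ : 0 < β) (hβd : β < d) (hR : IsPrototype R₀) :
    Tendsto (fun t => ∫⁻ x, ‖stepWeight α (siteFinset hR t) t x - limitG R₀ g x‖ₑ ^ 2)
      atTop (𝓝 0) := by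
  have hd : 0 < d := by
    have : (0 : ℝ) < d := hβ.trans hβd
    exact_mod_cast this
  have hBm : MeasurableSet (Metric.ball (0 : EuclideanSpace ℝ (Fin d)) 1) := measurableSet_ball
  obtain ⟨W₁, W₂, hW₁, hW₂, hev⟩ := h.exists_uniform_bounds hα hC1 hg hβ hβd
  obtain ⟨M, hM, hMev⟩ := h.exists_sq_lintegral_cellSet_le hα hC1 hg hβ hβd hR
  obtain ⟨T, -, w, hw, hwi, H⟩ := hC1.exists_dominating hα hβ hβd
  have hnear := h.tendsto_lintegral_ball hg hβd.le hd hw hwi fun t ht => (H t ht).2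
  have hfar := h.tendsto_sq hβd.le one_pos
  have hvol := hR.tendsto_volume_boundaryLayer
  set V := fun t => volume (boundaryLayer R₀ t) with hV
  -- The bound comes from two uses of the Young-type inequality: `g_t` over the boundary layer, and
  -- `g_t - g` over `R₀`.
  have hlim : Tendsto (fun t : ℝ => 4 * (4 * (V t * W₁ ^ 2 + V t ^ 2 * W₂) +
      4 * (volume R₀ * (∫⁻ z in Metric.ball 0 1, ‖rescaled α t z - g z‖ₑ) ^ 2
        + volume R₀ ^ 2 * ∫⁻ z in (Metric.ball 0 1)ᶜ, ‖rescaled α t z - g z‖ₑ ^ 2)))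
      atTop (𝓝 0) := by
    have e1 : Tendsto (fun t => V t * W₁ ^ 2) atTop (𝓝 0) := by
      simpa using ENNReal.Tendsto.mul_const hvol (Or.inr (ENNReal.pow_ne_top (n := 2) hW₁))
    have e2 : Tendsto (fun t => V t ^ 2 * W₂) atTop (𝓝 0) := by
      simpa using ENNReal.Tendsto.mul_const (ENNReal.Tendsto.pow (n := 2) hvol) (Or.inr hW₂)
    have e3 := ENNReal.Tendsto.const_mul (ENNReal.Tendsto.pow (n := 2) hnear)
      (Or.inr hR.volume_ne_top)
    have e4 := ENNReal.Tendsto.const_mul hfar (Or.inr (ENNReal.pow_ne_top (n := 2)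
      hR.volume_ne_top))
    have h4 : (4 : ℝ≥0∞) ≠ ∞ := by norm_num
    have := ENNReal.Tendsto.const_mul ((ENNReal.Tendsto.const_mul (e1.add e2) (Or.inr h4)).add
      (ENNReal.Tendsto.const_mul (e3.add e4) (Or.inr h4))) (Or.inr h4)
    simpa using this
  refine tendsto_of_tendsto_of_tendsto_of_le_of_le' tendsto_const_nhds hlim
    (Eventually.of_forall fun _ => zero_le) ?_
  filter_upwards [hev, hMev, eventually_gt_atTop 0] with t ht htM ht0
  have hrm : Measurable fun z => ‖rescaled α t z‖ₑ := (measurable_rescaled t).enorm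
  have hDm : Measurable fun z => ‖rescaled α t z - g z‖ₑ :=
    ((measurable_rescaled t).sub hg).enorm
  have hpt : ∀ x, ‖stepWeight α (siteFinset hR t) t x - limitG R₀ g x‖ₑ
      ≤ (∫⁻ z in boundaryLayer R₀ t, ‖rescaled α t (z - x)‖ₑ)
        + ∫⁻ z in R₀, ‖rescaled α t (z - x) - g (z - x)‖ₑ := by
    intro x
    have hm : Measurable fun z => rescaled α t (z - x) :=
      (measurable_rescaled t).comp (measurable_sub_const x)
    rw [stepWeight_eq_setIntegral _ ht0, limitG]
    refine enorm_setIntegral_sub_setIntegral_le (measurableSet_cellSet _ t x)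
      hR.isOpen.measurableSet (measurableSet_boundaryLayer t)
      (fun z hz => mem_boundaryLayer hR ht0 hz) ⟨hm.aestronglyMeasurable, ?_⟩
      (h.integrableOn_sub hα hC1 hg hβ hβd hR x) hm
    refine lt_top_iff_ne_top.2 fun htop => ?_
    have := ne_top_of_le_ne_top hM (htM x)
    simp [htop] at this
  have hm1 : Measurable fun x => (∫⁻ z in boundaryLayer R₀ t, ‖rescaled α t (z - x)‖ₑ) ^ 2 :=
    ((hrm.comp (measurable_snd.sub measurable_fst)).lintegral_prod_right'
      (f := fun p : EuclideanSpace ℝ (Fin d) × EuclideanSpace ℝ (Fin d) =>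
        ‖rescaled α t (p.2 - p.1)‖ₑ)).pow_const 2
  calc ∫⁻ x, ‖stepWeight α (siteFinset hR t) t x - limitG R₀ g x‖ₑ ^ 2
      ≤ ∫⁻ x, 4 * ((∫⁻ z in boundaryLayer R₀ t, ‖rescaled α t (z - x)‖ₑ) ^ 2
        + (∫⁻ z in R₀, ‖rescaled α t (z - x) - g (z - x)‖ₑ) ^ 2) :=
        lintegral_mono fun x => (pow_le_pow_left' (hpt x) 2).trans (ennreal_add_sq_le _ _)
    _ = 4 * ((∫⁻ x, (∫⁻ z in boundaryLayer R₀ t, ‖rescaled α t (z - x)‖ₑ) ^ 2)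
        + ∫⁻ x, (∫⁻ z in R₀, ‖rescaled α t (z - x) - g (z - x)‖ₑ) ^ 2) := by
        rw [lintegral_const_mul' _ _ (by norm_num), lintegral_add_left hm1]
    _ ≤ _ := by
        refine mul_le_mul_right (add_le_add ?_ ?_) 4
        · refine (lintegral_sq_setLIntegral_sub_le hrm _ hBm).trans ?_
          gcongr
          · exact ht.1
          · exact ht.2
        · exact lintegral_sq_setLIntegral_sub_le hDm _ hBm

end Limit

/-! ### Sum of squares and negligibility of the normalized weights. -/

section Normalization

open scoped ENNReal

variable {d : ℕ} {α : (Fin d → ℤ) → ℝ} {β : ℝ} {L : ℝ → ℝ} {g : EuclideanSpace ℝ (Fin d) → ℝ}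
  {R₀ : Set (EuclideanSpace ℝ (Fin d))}

lemma tendsto_lintegral_sq_of_tendsto_sub {X : Type*} [MeasurableSpace X] {μ : Measure X}
    {κ : Type*} {l : Filter κ} {f : κ → X → ℝ} {G : X → ℝ} (hf : ∀ n, Measurable (f n))
    (hG : MemLp G 2 μ) (h : Tendsto (fun n => ∫⁻ x, ‖f n x - G x‖ₑ ^ 2 ∂μ) l (𝓝 0)) :
    Tendsto (fun n => ∫⁻ x, ‖f n x‖ₑ ^ 2 ∂μ) l (𝓝 (∫⁻ x, ‖G x‖ₑ ^ 2 ∂μ)) := by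
  have hnorm : Tendsto (fun n => eLpNorm (f n - G) 2 μ) l (𝓝 0) := by
    have h1 := (ENNReal.continuous_rpow_const (y := (1 / 2 : ℝ))).tendsto 0 |>.comp h
    rw [ENNReal.zero_rpow_of_pos (by norm_num)] at h1
    refine h1.congr fun n => ?_
    have h2 := eLpNorm_two_sq (μ := μ) (f n - G)
    simp only [Pi.sub_apply] at h2
    simp only [Function.comp_apply]
    rw [← h2, ← ENNReal.rpow_natCast, ← ENNReal.rpow_mul]
    norm_num
  have hlow : Tendsto (fun n => eLpNorm G 2 μ - eLpNorm (f n - G) 2 μ) l (𝓝 (eLpNorm G 2 μ)) := by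
    simpa using ENNReal.Tendsto.sub (tendsto_const_nhds (x := eLpNorm G 2 μ)) hnorm
      (Or.inl hG.2.ne)
  have hupp : Tendsto (fun n => eLpNorm G 2 μ + eLpNorm (f n - G) 2 μ) l (𝓝 (eLpNorm G 2 μ)) := by
    simpa using (tendsto_const_nhds (x := eLpNorm G 2 μ)).add hnorm
  have hfG : ∀ n, AEStronglyMeasurable (f n - G) μ := fun n =>
    (hf n).aestronglyMeasurable.sub hG.1
  have hmain : Tendsto (fun n => eLpNorm (f n) 2 μ) l (𝓝 (eLpNorm G 2 μ)) := by
    refine tendsto_of_tendsto_of_tendsto_of_le_of_le hlow hupp (fun n => ?_) (fun n => ?_)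
    · refine tsub_le_iff_right.2 ?_
      have := eLpNorm_sub_le (μ := μ) (p := 2) (hf n).aestronglyMeasurable (hfG n) one_le_two
      simpa using this
    · have := eLpNorm_add_le (μ := μ) (p := 2) hG.1 (hfG n) one_le_two
      simpa using this
  simp_rw [← eLpNorm_two_sq]
  exact ENNReal.Tendsto.pow hmain

lemma summable_sq_weight (hα : Summable fun i => α i ^ 2) (F : Finset (Fin d → ℤ)) :
    Summable fun j => weight α F j ^ 2 := by
  have h1 : Summable fun j => (F.card : ℝ) * ∑ i ∈ F, α (i - j) ^ 2 := by
    refine Summable.mul_left _ (summable_sum fun i _ => ?_)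
    exact (Equiv.subLeft i).summable_iff.2 hα
  refine Summable.of_nonneg_of_le (fun _ => sq_nonneg _) (fun j => ?_) h1
  exact sq_sum_le_card_mul_sum_sq

/-- The normalizing constant of the sums over the inflated region. -/
noncomputable def normalizer (d : ℕ) (β : ℝ) (L : ℝ → ℝ) (t : ℝ) : ℝ :=
  (t ^ (3 * (d : ℝ) - 2 * β) * L t ^ 2) ^ (1 / 2 : ℝ)

lemma CondC1.normalizer_sq (hC1 : CondC1 α β L) {t : ℝ} (ht : 0 < t) :
    normalizer d β L t ^ 2 = t ^ d * (t ^ d * radialMax α t) ^ 2 := by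
  rw [normalizer, ← Real.sqrt_eq_rpow, Real.sq_sqrt (by positivity), hC1.radialMax_eq t ht,
    Real.rpow_sub ht, mul_comm 3 (d : ℝ), Real.rpow_mul ht.le, Real.rpow_natCast,
    mul_comm 2 β, Real.rpow_mul ht.le, Real.rpow_neg ht.le]
  have : t ^ β ≠ 0 := (Real.rpow_pos_of_pos ht _).ne'
  norm_cast
  field_simp

lemma CondC1.sq_weight_div (hC1 : CondC1 α β L) {t : ℝ} (ht : 0 < t) (F : Finset (Fin d → ℤ))
    (j : Fin d → ℤ) : (weight α F j / normalizer d β L t) ^ 2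
      = (t ^ d)⁻¹ * (weight α F j / (t ^ d * radialMax α t)) ^ 2 := by
  rw [div_pow, hC1.normalizer_sq ht, div_pow, ← div_div, div_right_comm]
  ring

/-- The step function is constant on cells of volume `t^(-d)`, exactly the factor separating the two
normalizations. -/
lemma CondC1.ofReal_tsum_sq (hα : Summable fun i => α i ^ 2) (hC1 : CondC1 α β L) {t : ℝ}
    (ht : 0 < t) (F : Finset (Fin d → ℤ)) :
    ENNReal.ofReal (∑' j, (weight α F j / normalizer d β L t) ^ 2)
      = ∫⁻ x, ‖stepWeight α F t x‖ₑ ^ 2 := by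
  have hs : Summable fun j => (weight α F j / normalizer d β L t) ^ 2 := by
    simp_rw [div_pow]; exact (summable_sq_weight hα F).div_const _
  have e := lintegral_comp_floorVec_smul ht
    (fun j => ‖weight α F j / (t ^ d * radialMax α t)‖ₑ ^ 2)
  change ∫⁻ x, ‖stepWeight α F t x‖ₑ ^ 2 = _ at e
  rw [e, ENNReal.ofReal_tsum_of_nonneg (fun _ => sq_nonneg _) hs, ← ENNReal.tsum_mul_left]
  refine tsum_congr fun j => ?_
  rw [hC1.sq_weight_div ht, ENNReal.ofReal_mul (by positivity), Real.enorm_eq_ofReal_abs,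
    ← ENNReal.ofReal_pow (abs_nonneg _), sq_abs]

lemma CondC2.tendsto_tsum_sq (hα : Summable fun i => α i ^ 2) (hC1 : CondC1 α β L)
    (h : CondC2 α β g) (hg : Measurable g) (hβ : 0 < β) (hβd : β < d) (hR : IsPrototype R₀) :
    Tendsto (fun t => ∑' j, (weight α (siteFinset hR t) j / normalizer d β L t) ^ 2) atTop
      (𝓝 (∫ x, limitG R₀ g x ^ 2)) := by
  have hG := h.memLp_limitG hα hC1 hg hβ hβd hR
  have h1 := tendsto_lintegral_sq_of_tendsto_sub
    (fun t => measurable_stepWeight (α := α) (siteFinset hR t) t) hG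
    (h.tendsto_stepWeight hα hC1 hg hβ hβd hR)
  have hfin : ∫⁻ x, ‖limitG R₀ g x‖ₑ ^ 2 ≠ ∞ := by
    rw [← eLpNorm_two_sq]; exact ENNReal.pow_ne_top hG.2.ne
  have h2 := (ENNReal.tendsto_toReal hfin).comp h1
  have h3 : (∫⁻ x, ‖limitG R₀ g x‖ₑ ^ 2).toReal = ∫ x, limitG R₀ g x ^ 2 := by
    rw [integral_eq_lintegral_of_nonneg_ae (ae_of_all _ fun _ => sq_nonneg _)
      ((measurable_limitG hg).pow_const 2).aestronglyMeasurable]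
    congr 2 with x
    rw [Real.enorm_eq_ofReal_abs, ← ENNReal.ofReal_pow (abs_nonneg _), sq_abs]
  rw [h3] at h2
  refine h2.congr' ?_
  filter_upwards [eventually_gt_atTop 0] with t ht
  rw [Function.comp_apply, ← hC1.ofReal_tsum_sq hα ht,
    ENNReal.toReal_ofReal (tsum_nonneg fun _ => sq_nonneg _)]

lemma floorVec_latticePt {t : ℝ} (ht : 0 < t) (j : Fin d → ℤ) :
    floorVec (t • t⁻¹ • latticePt j) = j := by
  rw [smul_smul, mul_inv_cancel₀ ht.ne', one_smul]
  ext k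
  simp [floorVec, latticePt]

/-- The normalized weights are uniformly negligible. -/
lemma CondC2.eventually_abs_weight_le (hα : Summable fun i => α i ^ 2) (hC1 : CondC1 α β L)
    (h : CondC2 α β g) (hg : Measurable g) (hβ : 0 < β) (hβd : β < d) (hR : IsPrototype R₀)
    {η : ℝ} (hη : 0 < η) :
    ∀ᶠ t in atTop, ∀ j, |weight α (siteFinset hR t) j / normalizer d β L t| ≤ η := by
  have hd : d ≠ 0 := by
    rintro rfl
    exact absurd (hβ.trans hβd) (by simp)
  obtain ⟨M, hM, hev⟩ := h.exists_sq_lintegral_cellSet_le hα hC1 hg hβ hβd hR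
  have hlim : Tendsto (fun t : ℝ => (t ^ d)⁻¹ * M.toReal) atTop (𝓝 0) := by
    simpa using (tendsto_inv_atTop_zero.comp (tendsto_pow_atTop (α := ℝ) hd)).mul_const M.toReal
  filter_upwards [hev, eventually_gt_atTop 0,
    hlim.eventually (gt_mem_nhds (show (0 : ℝ) < η ^ 2 by positivity))] with t ht ht0 hsmall j
  refine abs_le_of_sq_le_sq ?_ hη.le
  rw [hC1.sq_weight_div ht0]
  refine le_trans (mul_le_mul_of_nonneg_left ?_ (by positivity)) hsmall.le
  -- Every weight is a value of the step function, bounded uniformly in `x`; the decay comes from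
  -- `t^(-d)` alone.
  set x : EuclideanSpace ℝ (Fin d) := t⁻¹ • latticePt j
  have e : weight α (siteFinset hR t) j / (t ^ d * radialMax α t)
      = stepWeight α (siteFinset hR t) t x := by
    rw [stepWeight, floorVec_latticePt ht0]
  have hle : ‖stepWeight α (siteFinset hR t) t x‖ₑ ^ 2 ≤ M := by
    rw [stepWeight_eq_setIntegral _ ht0]
    exact (pow_le_pow_left' (enorm_integral_le_lintegral_enorm _) 2).trans (ht x)
  rw [e, ← ENNReal.ofReal_le_iff_le_toReal hM]
  rwa [Real.enorm_eq_ofReal_abs, ← ENNReal.ofReal_pow (abs_nonneg _), sq_abs] at hle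

end Normalization

/-! ### The centred sum as a series of innovations. -/

section LinearProcess

variable {d : ℕ} {Ω : Type*} {R₀ : Set (EuclideanSpace ℝ (Fin d))}
  {m : ℝ} {α : (Fin d → ℤ) → ℝ} {ε Z : (Fin d → ℤ) → Ω → ℝ}

lemma siteSum_eq (hR : IsPrototype R₀) (t : ℝ) (ω : Ω) :
    siteSum R₀ t Z ω = ∑ i ∈ siteFinset hR t, Z i ω :=
  finsum_mem_eq_finite_toFinset_sum _ (sites_finite hR t)

variable [MeasurableSpace Ω] {P : Measure Ω}

lemma IsInnovation.integral_sq (hε : IsInnovation P ε) (j : Fin d → ℤ) :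
    ∫ ω, ε j ω ^ 2 ∂P = 1 := by
  rw [← hε.variance j, variance_of_integral_eq_zero (hε.measurable j).aemeasurable (hε.mean j)]

variable [IsProbabilityMeasure P]

lemma IsInnovation.memLp_partialSum (hε : IsInnovation P ε) (i : Fin d → ℤ)
    (F : Finset (Fin d → ℤ)) : MemLp (fun ω => m + ∑ j ∈ F, α (i - j) * ε j ω) 2 P :=
  (memLp_const m).add (memLp_finsetSum F fun j _ => (hε.memLp j).const_mul _)

lemma IsInnovation.integral_partialSum (hε : IsInnovation P ε) (i : Fin d → ℤ)
    (F : Finset (Fin d → ℤ)) : ∫ ω, (m + ∑ j ∈ F, α (i - j) * ε j ω) ∂P = m := by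
  have hint : ∀ j ∈ F, Integrable (fun ω => α (i - j) * ε j ω) P := fun j _ =>
    ((hε.memLp j).integrable one_le_two).const_mul _
  rw [integral_add (integrable_const _) (integrable_finsetSum F hint), integral_finsetSum F hint]
  simp [integral_const_mul, hε.mean]

lemma IsLinearProcess.memLp (hZ : IsLinearProcess P m α ε Z) (hε : IsInnovation P ε)
    (i : Fin d → ℤ) : MemLp (Z i) 2 P := by
  obtain ⟨F, hF⟩ := ((hZ.tendsto i).eventually (gt_mem_nhds one_pos)).exists
  have h1 : MemLp (fun ω => Z i ω - (m + ∑ j ∈ F, α (i - j) * ε j ω)) 2 P :=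
    ⟨(hZ.aemeasurable i).aestronglyMeasurable.sub (hε.memLp_partialSum i F).1,
      hF.trans ENNReal.one_lt_top⟩
  have h2 := h1.add (hε.memLp_partialSum (m := m) (α := α) i F)
  refine h2.ae_eq (ae_of_all _ fun ω => ?_)
  simp

/-- Every partial sum has mean `m`, and on a probability space means differ by at most the `L²`
distance. -/
lemma IsLinearProcess.integral_eq (hZ : IsLinearProcess P m α ε Z) (hε : IsInnovation P ε)
    (i : Fin d → ℤ) : ∫ ω, Z i ω ∂P = m := by
  have hbd : ∀ F : Finset (Fin d → ℤ), ‖∫ ω, Z i ω ∂P - m‖ₑ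
      ≤ eLpNorm (fun ω => Z i ω - (m + ∑ j ∈ F, α (i - j) * ε j ω)) 2 P := by
    intro F
    have hp := hε.memLp_partialSum (m := m) (α := α) i F
    have hz := hZ.memLp hε i
    nth_rewrite 1 [← hε.integral_partialSum (m := m) (α := α) i F]
    rw [← integral_sub (hz.integrable one_le_two) (hp.integrable one_le_two)]
    refine (enorm_integral_le_lintegral_enorm _).trans ?_
    rw [← eLpNorm_one_eq_lintegral_enorm]
    exact eLpNorm_le_eLpNorm_of_exponent_le one_le_two (hz.sub hp).1
  have := ge_of_tendsto' (hZ.tendsto i) hbd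
  exact sub_eq_zero.1 (enorm_eq_zero.1 (le_antisymm this zero_le))

lemma IsLinearProcess.integral_siteSum (hZ : IsLinearProcess P m α ε Z) (hε : IsInnovation P ε)
    (hR : IsPrototype R₀) (t : ℝ) :
    ∫ ω, siteSum R₀ t Z ω ∂P = ∑ _i ∈ siteFinset hR t, m := by
  simp_rw [siteSum_eq hR]
  rw [integral_finsetSum _ fun i _ => (hZ.memLp hε i).integrable one_le_two]
  simp_rw [hZ.integral_eq hε]

/-- The centred and rescaled sum is a weighted series of innovations in mean square. -/
lemma IsLinearProcess.tendsto_siteSum (hZ : IsLinearProcess P m α ε Z) (hε : IsInnovation P ε)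
    (hR : IsPrototype R₀) (t b : ℝ) :
    Tendsto (fun J : Finset (Fin d → ℤ) => eLpNorm (fun ω =>
      (siteSum R₀ t Z ω - ∫ ω', siteSum R₀ t Z ω' ∂P) / b
        - ∑ j ∈ J, weight α (siteFinset hR t) j / b * ε j ω) 2 P) atTop (𝓝 0) := by
  set F := siteFinset hR t
  have hlim : Tendsto (fun J : Finset (Fin d → ℤ) => ‖b⁻¹‖ₑ * ∑ i ∈ F,
      eLpNorm (fun ω => Z i ω - (m + ∑ j ∈ J, α (i - j) * ε j ω)) 2 P) atTop (𝓝 0) := by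
    have h1 := tendsto_finsetSum F fun i _ => hZ.tendsto i
    have h2 := ENNReal.Tendsto.const_mul h1 (Or.inr (enorm_ne_top (x := b⁻¹)))
    simpa using h2
  refine tendsto_of_tendsto_of_tendsto_of_le_of_le tendsto_const_nhds hlim (fun _ => zero_le) ?_
  intro J
  -- Both sums are finite, so their interchange is algebraic; `b = 0` is allowed, since the
  -- normalizer may vanish for small `t`.
  have e : (fun ω => (siteSum R₀ t Z ω - ∫ ω', siteSum R₀ t Z ω' ∂P) / b
        - ∑ j ∈ J, weight α F j / b * ε j ω)
      = b⁻¹ • ∑ i ∈ F, fun ω => Z i ω - (m + ∑ j ∈ J, α (i - j) * ε j ω) := by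
    ext ω
    rw [hZ.integral_siteSum hε hR, siteSum_eq hR, Pi.smul_apply, Finset.sum_apply, smul_eq_mul]
    simp only [weight, Finset.sum_sub_distrib, Finset.sum_add_distrib, F]
    rw [Finset.sum_comm (s := siteFinset hR t) (t := J)]
    simp_rw [← Finset.sum_mul, div_mul_eq_mul_div]
    rw [← Finset.sum_div]
    ring
  simp only
  rw [e, eLpNorm_const_smul]
  gcongr
  exact eLpNorm_sum_le (fun i _ => ((hZ.memLp hε i).sub (hε.memLp_partialSum i J)).1) one_le_two

end LinearProcess

/-! ### Replacing `g` by a measurable representative. -/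

section Modification

variable {d : ℕ} {α : (Fin d → ℤ) → ℝ} {β : ℝ} {g g' : EuclideanSpace ℝ (Fin d) → ℝ}
  {R₀ : Set (EuclideanSpace ℝ (Fin d))}

lemma ae_eq_comp_sub (h : g =ᵐ[volume] g') (x : EuclideanSpace ℝ (Fin d)) :
    (fun y => g (y - x)) =ᵐ[volume] fun y => g' (y - x) :=
  (measurePreserving_sub_right volume x).quasiMeasurePreserving.ae_eq_comp h

/-- Translations preserve null sets, so the two functions agree at every point. -/
lemma limitG_congr (h : g =ᵐ[volume] g') : limitG R₀ g = limitG R₀ g' := by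
  ext x
  exact integral_congr_ae (ae_restrict_of_ae (ae_eq_comp_sub h x))

lemma CondC2.congr (hC2 : CondC2 α β g) (h : g =ᵐ[volume] g') : CondC2 α β g' where
  aemeasurable := hC2.aemeasurable.congr h
  tendsto δ hδ := by
    refine (hC2.tendsto δ hδ).congr fun t => lintegral_congr_ae (ae_restrict_of_ae ?_)
    filter_upwards [h] with x hx
    rw [hx]

end Modification

end SpatialLinear

/-! ### Assembly of the main theorem. -/

theorem theorem3p2 {d : ℕ} {Ω : Type*} [MeasurableSpace Ω] (P : Measure Ω)
    [IsProbabilityMeasure P]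
    (m : ℝ) (α : (Fin d → ℤ) → ℝ) (hα : Summable (fun i => α i ^ 2))
    (ε Z : (Fin d → ℤ) → Ω → ℝ)
    (hε : SpatialLinear.IsInnovation P ε)
    (hZ : SpatialLinear.IsLinearProcess P m α ε Z)
    (R₀ : Set (EuclideanSpace ℝ (Fin d))) (hR₀ : SpatialLinear.IsPrototype R₀)
    (lam : ℕ → ℝ) (hlam_pos : ∀ n, 0 < lam n) (hlam : Tendsto lam atTop atTop)
    (β : ℝ) (hβ : β ∈ Set.Ioo ((d : ℝ) / 2) (d : ℝ))
    (L : ℝ → ℝ) (hC1 : SpatialLinear.CondC1 α β L)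
    (g : EuclideanSpace ℝ (Fin d) → ℝ) (hC2 : SpatialLinear.CondC2 α β g) :
    (∀ x, IntegrableOn (fun y => g (y - x)) R₀ volume) ∧
    MemLp (SpatialLinear.limitG R₀ g) 2 volume ∧
    TendstoInDistribution
      (fun (n : ℕ) (ω : Ω) =>
        (SpatialLinear.siteSum R₀ (lam n) Z ω
            - ∫ ω', SpatialLinear.siteSum R₀ (lam n) Z ω' ∂P)
          / (lam n ^ (3 * (d : ℝ) - 2 * β) * L (lam n) ^ 2) ^ (1 / 2 : ℝ))
      atTop (id : ℝ → ℝ) (fun _ => P)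
      (gaussianReal 0 (∫ x, SpatialLinear.limitG R₀ g x ^ 2).toNNReal) := by
  have hβ0 : 0 < β := lt_of_le_of_lt (by positivity) hβ.1
  have hβd : β < d := hβ.2
  have hae := hC2.aemeasurable.ae_eq_mk
  have hg := hC2.aemeasurable.measurable_mk
  have hC2' := hC2.congr hae
  rw [SpatialLinear.limitG_congr hae]
  refine ⟨fun x => ?_, hC2'.memLp_limitG hα hC1 hg hβ0 hβd hR₀, ?_⟩
  · have hx := ae_restrict_of_ae (s := R₀) (SpatialLinear.ae_eq_comp_sub hae x)
    exact (hC2'.integrableOn_sub hα hC1 hg hβ0 hβd hR₀ x).congr (EventuallyEq.symm hx)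
  · refine SpatialLinear.tendstoInDistribution_weighted_series hε.measurable hε.indep hε.memLp
      hε.mean hε.integral_sq hε.uniformIntegrable
      (c := fun n j => SpatialLinear.weight α (SpatialLinear.siteFinset hR₀ (lam n)) j
        / SpatialLinear.normalizer d β L (lam n)) (fun n => ?_) ?_ (fun η hη => ?_) (fun n => ?_)
      (fun n => hZ.tendsto_siteSum hε hR₀ (lam n) _)
    · simp_rw [div_pow]
      exact (SpatialLinear.summable_sq_weight hα _).div_const _
    · rw [Real.coe_toNNReal _ (integral_nonneg fun _ => sq_nonneg _)]
      exact (hC2'.tendsto_tsum_sq hα hC1 hg hβ0 hβd hR₀).comp hlam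
    · exact hlam.eventually (hC2'.eventually_abs_weight_le hα hC1 hg hβ0 hβd hR₀ hη)
    · refine AEMeasurable.div_const (AEMeasurable.sub_const ?_ _) _
      rw [show SpatialLinear.siteSum R₀ (lam n) Z
        = fun ω => ∑ i ∈ SpatialLinear.siteFinset hR₀ (lam n), Z i ω from
          funext (SpatialLinear.siteSum_eq hR₀ _)]
      exact Finset.aemeasurable_fun_sum _ fun i _ => hZ.aemeasurable i
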